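/- Let $G$ be a finite simple graph on the vertex set $V$, let $m,n\ge 1$, let $K$ be a field, $S=K[x_v : v\in V]$ with its $\mathbb N^V$-grading, $\mathfrak m=(x_v : v\in V)$, and let $I(G)=(x_ux_v : \{u,v\}\in E(G))\subset S$ be the edge ideal. Suppose that $G$ contains a complete bipartite graph of type $(m,n)$ as a spanning subgraph. Then: (1) There is an ordering $g_1,\dots,g_\mu$ of the minimal monomial generators of $I(G)$ with the following property. For $\ell_1<\cdots<\ell_s$ let $e_{\ell_1\cdots\ell_s}$ be the corresponding symbol of the Taylor resolution $T_\bullet$ of $S/I(G)$, of multidegree $\deg\operatorname{lcm}(g_{\ell_1},\dots,g_{\ell_s})$, and let $d$ be the Taylor differential, $$d(e_{\ell_1\cdots\ell_s})=\sum_{t=1}^s(-1)^{t-1}\frac{\operatorname{lcm}(g_{\ell_1},\dots,g_{\ell_s})}{\operatorname{lcm}(g_{\ell_1},\dots,\widehat{g_{\ell_t}},\dots,g_{\ell_s})}\,e_{\ell_1\cdots\widehat{\ell_t}\cdots\ell_s}.$$ Call a symbol $L$-admissible if $g_q\nmid\operatorname{lcm}(g_{\ell_t},\dots,g_{\ell_s})$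 for all $1\le t<s$ and $q<\ell_t$; call an $L$-admissible symbol maximal if no symbol on a strictly larger set of indices is $L$-admissible; and let $L_s\subseteq T_s$ be the $S$-submodule generated by the $L$-admissible symbols with $s$ indices (so $L_\bullet$ is the Lyubeznik resolution for this ordering). Then, with $s=m+n-1$, there are a maximal $L$-admissible symbol $e_\tau\in L_s$ of multidegree $V$ (that is, $(1,\dots,1)\in\mathbb N^V$) and elements $a_{\tau'}\in S$, for the $L$-admissible symbols $e_{\tau'}\in L_s$ with $\tau'\ne\tau$, such that $$d\Big(e_\tau+\sum_{\tau'\neq\tau}a_{\tau'}e_{\tau'}\Big)\in\mathfrak m L_{s-1}.$$ (2) The multigraded Betti number $\beta_{m+n-1,V}(S/I(G))$, i.e. the number of copies of $S(-(1,\dots,1))$ in homological degree $m+n-1$ of a minimal $\mathbb N^V$-graded free resolution of $S/I(G)$, is nonzero. -/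

import Mathlib

open scoped Classical in
/-- The `(0,1)`-vector in `ℕ^V` of a set `σ` of vertices. -/
noncomputable def zeroOneVector {V : Type*} (σ : Finset V) : V →₀ ℕ :=
  ∑ v ∈ σ, Finsupp.single v 1

/-- The edge ideal of `G` in the polynomial ring `K[V]`: it is generated by the products `x_u x_v`
over all edges `{u, v}` of `G`. -/
noncomputable def edgeIdeal (K : Type*) [Field K] {V : Type*} (G : SimpleGraph V) :
    Ideal (MvPolynomial V K) :=
  Ideal.span {p | ∃ u v, G.Adj u v ∧ p = MvPolynomial.X u * MvPolynomial.X v}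

/-- `G` contains a complete bipartite graph of type `(m, n)` as a spanning subgraph. (A graph `B`
on the same vertex type as `G` with `B ≤ G` is precisely a spanning subgraph of `G`.) -/
def HasSpanningCompleteBipartite {V : Type*} (G : SimpleGraph V) (m n : ℕ) : Prop :=
  ∃ B : SimpleGraph V, B ≤ G ∧ Nonempty (B ≃g completeBipartiteGraph (Fin m) (Fin n))

/-- The ideal generated by all variables. -/
noncomputable def variablesIdeal (V K : Type*) [Field K] : Ideal (MvPolynomial V K) :=
  Ideal.span (Set.range MvPolynomial.X)

/-! ### Multigraded Betti numbers -/

/-- An `ℕ^V`-graded free resolution `⋯ → F 2 → F 1 → F 0 → S/I → 0`, where `S = K[V]` and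
`F i = ⨁_b S(-deg i b)` is a free module of finite rank with homogeneous basis `e_b`,
`b : Fin (rank i)`. All maps are homogeneous of multidegree zero. -/
structure MultigradedFreeResolution {V K : Type*} [Field K] (I : Ideal (MvPolynomial V K)) where
  /-- the rank of `F i` -/
  rank : ℕ → ℕ
  /-- the multidegrees of the basis elements of `F i` -/
  deg : ∀ i, Fin (rank i) → V →₀ ℕ
  /-- the differential `F (i + 1) → F i` -/
  d : ∀ i, (Fin (rank (i + 1)) → MvPolynomial V K) →ₗ[MvPolynomial V K]
    (Fin (rank i) → MvPolynomial V K)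
  /-- the augmentation `F 0 → S/I` -/
  aug : (Fin (rank 0) → MvPolynomial V K) →ₗ[MvPolynomial V K] (MvPolynomial V K ⧸ I)
  /-- The `b'`-th coordinate of `d e_b` is homogeneous of multidegree `deg e_b - deg e_b'`
  (hence zero if this difference is not in `ℕ^V`). -/
  d_homogeneous : ∀ i b b', ∀ u ∈ (d i (Pi.single b 1) b').support,
    deg i b' + u = deg (i + 1) b
  /-- `aug e_b` is a homogeneous element of `S/I` of multidegree `deg e_b`. -/
  aug_homogeneous : ∀ b, ∃ c : K,
    aug (Pi.single b 1) = Ideal.Quotient.mk I (MvPolynomial.monomial (deg 0 b) c)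
  aug_surjective : Function.Surjective aug
  exact_zero : LinearMap.range (d 0) = LinearMap.ker aug
  exact_succ : ∀ i, LinearMap.range (d (i + 1)) = LinearMap.ker (d i)

/-- A resolution is minimal if `d (F (i + 1)) ⊆ 𝔪 F i` for all `i`, where `𝔪` is the ideal
generated by the variables. -/
def MultigradedFreeResolution.IsMinimal {V K : Type*} [Field K] {I : Ideal (MvPolynomial V K)}
    (F : MultigradedFreeResolution I) : Prop :=
  ∀ i, LinearMap.range (F.d i) ≤
    variablesIdeal V K • (⊤ : Submodule (MvPolynomial V K) (Fin (F.rank i) → MvPolynomial V K))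

/-- The number of copies of `S(-σ)` in the `i`-th module of a graded free resolution. -/
noncomputable def MultigradedFreeResolution.multiplicity {V K : Type*} [Field K]
    {I : Ideal (MvPolynomial V K)} (F : MultigradedFreeResolution I) (i : ℕ) (σ : V →₀ ℕ) : ℕ :=
  Nat.card {b : Fin (F.rank i) // F.deg i b = σ}

open scoped Classical in
/-- The multigraded Betti number `β_{i,σ}(S/I)`: the number of copies of `S(-σ)` in homological
degree `i` of a minimal `ℕ^V`-graded free resolution of `S/I`. Such a resolution is unique up to
isomorphism; if there were none, the value would be `0`. -/
noncomputable def multigradedBetti {V K : Type*} [Field K] (I : Ideal (MvPolynomial V K))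
    (i : ℕ) (σ : V →₀ ℕ) : ℕ :=
  if h : Nonempty {F : MultigradedFreeResolution I // F.IsMinimal} then
    (Classical.choice h).1.multiplicity i σ
  else 0

/-! ### Taylor and Lyubeznik resolutions -/

/-- The minimal monomial generators of a monomial ideal, given by their exponents: the monomials
in `I` that are minimal for divisibility. -/
def minimalMonomialGenerators {V K : Type*} [Field K] (I : Ideal (MvPolynomial V K)) :
    Set (V →₀ ℕ) :=
  {a | Minimal (fun b => MvPolynomial.monomial b (1 : K) ∈ I) a}

/-- The multidegree of the symbol `e_τ`, i.e. the exponent of `lcm (g ℓ : ℓ ∈ τ)`, where `g` lists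
the exponents of a sequence of monomials. A symbol `e_{ℓ₁ ⋯ ℓ_s}`, `ℓ₁ < ⋯ < ℓ_s`, is given by the
set `τ = {ℓ₁, …, ℓ_s}` of its indices. -/
noncomputable def symbolDegree {V : Type*} {μ : ℕ} (g : Fin μ → V →₀ ℕ) (τ : Finset (Fin μ)) :
    V →₀ ℕ :=
  τ.sup g

/-- The differential of the Taylor complex. The complex is presented as the free module on all
symbols, including the empty symbol `e_∅` which spans `T_0 = S`; its component `T_s` is spanned by
the symbols with `s` indices. The sign of the summand omitting `ℓ = ℓ_t` is `(-1)^(t-1)`. -/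
noncomputable def taylorDifferential (K : Type*) [Field K] {V : Type*} {μ : ℕ}
    (g : Fin μ → V →₀ ℕ) :
    (Finset (Fin μ) →₀ MvPolynomial V K) →ₗ[MvPolynomial V K]
      (Finset (Fin μ) →₀ MvPolynomial V K) :=
  Finsupp.linearCombination (MvPolynomial V K) fun τ =>
    ∑ l ∈ τ, Finsupp.single (τ.erase l)
      (MvPolynomial.monomial (symbolDegree g τ - symbolDegree g (τ.erase l))
        ((-1 : K) ^ (τ.filter (· < l)).card))

/-- The symbol `e_{ℓ₁ ⋯ ℓ_s}` is `L`-admissible if for all `t < s` and `q < ℓ_t`,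
`lcm (g ℓ_t, …, g ℓ_s)` is not divisible by `g q`. -/
def LAdmissible {V : Type*} {μ : ℕ} (g : Fin μ → V →₀ ℕ) (τ : Finset (Fin μ)) : Prop :=
  ∀ l ∈ τ, (∃ k ∈ τ, l < k) → ∀ q < l, ¬ g q ≤ symbolDegree g (τ.filter (l ≤ ·))

/-- An `L`-admissible symbol is maximal if no symbol on a strictly larger set of indices is
`L`-admissible. -/
def IsMaximalLAdmissible {V : Type*} {μ : ℕ} (g : Fin μ → V →₀ ℕ) (τ : Finset (Fin μ)) : Prop :=
  LAdmissible g τ ∧ ∀ τ' : Finset (Fin μ), τ ⊂ τ' → ¬ LAdmissible g τ'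

/-- The component `L_s` of the Lyubeznik resolution, as a submodule of the Taylor resolution:
it is generated by all `L`-admissible symbols with `s` indices. -/
noncomputable def lyubeznik (K : Type*) [Field K] {V : Type*} {μ : ℕ} (g : Fin μ → V →₀ ℕ) (s : ℕ) :
    Submodule (MvPolynomial V K) (Finset (Fin μ) →₀ MvPolynomial V K) :=
  Submodule.span (MvPolynomial V K)
    {x | ∃ τ : Finset (Fin μ), LAdmissible g τ ∧ τ.card = s ∧ x = Finsupp.single τ 1}

open scoped Classical in
/-- There is a maximal `L`-admissible symbol `e_τ ∈ L_s` of multidegree `σ` and elements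
`a_τ'` of `S`, for the other `L`-admissible symbols `e_τ' ∈ L_s`, such that
`d (e_τ + ∑ a_τ' e_τ') ∈ 𝔪 L_{s-1}`. (Used for `s ≥ 1`.) -/
def HasMaximalCycle (K : Type*) [Field K] {V : Type*} {μ : ℕ} (g : Fin μ → V →₀ ℕ)
    (s : ℕ) (σ : V →₀ ℕ) : Prop :=
  ∃ (τ : Finset (Fin μ)) (a : Finset (Fin μ) → MvPolynomial V K),
    IsMaximalLAdmissible g τ ∧ τ.card = s ∧ symbolDegree g τ = σ ∧
    taylorDifferential K g
        (Finsupp.single τ 1 +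
          ∑ τ' ∈ Finset.univ.filter (fun τ' => LAdmissible g τ' ∧ τ'.card = s ∧ τ' ≠ τ),
            a τ' • Finsupp.single τ' 1) ∈
      variablesIdeal V K • lyubeznik K g (s - 1)

/-! ### Lattice paths -/

/-! Write `m = M + 1`, `n = N + 1`, and let `α i`, `β j` be the two sides of the bipartite subgraph.
The edges `α i β j` are listed first, lexicographically, and all other edges after them. For (1), a
lattice path from `(0, 0)` to `(M, N)` selects `M + N + 1` edges, which cover every vertex. With
this order each path is a maximal `L`-admissible symbol (`isMaximalLAdmissible_path`). Deleting a
point of the path that is not a turn uncovers a vertex, so the Taylor coefficient lies in `𝔪`.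
Deleting a turn leaves the multidegree unchanged and gives a unit coefficient, but the same face
arises from the path with that corner flipped. Signing each path by the parity of the sum of its
first coordinates makes these two terms cancel (`taylorDifferential_sum_path_mem`). For (2), which
is proved independently of (1), Tor is computed in multidegree `V` in two ways. No squarefree
monomial outside `I(G)` involves both sides, so the independence complex is disconnected, and the
indicator function of one side gives a nonzero Koszul class of `S/I(G)` in degree `|V| - 1 = m + n -
1`. A zigzag carries this class through a graded resolution and forces a generator of multidegree
`V` in that homological degree (`exists_degree_eq_univ_of_exact`, `exists_deg_eq_univ`). A minimal
graded resolution has to be constructed as well, since `multigradedBetti` is `0` by default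
(`nonempty_minimal_multigradedFreeResolution`). -/

section LatticePath

variable {M N : ℕ}

/-- A saturated chain from the bottom to the top of `Fin (M + 1) × Fin (N + 1)`. -/
def IsLatticePath (p : Fin (M + N + 1) → Fin (M + 1) × Fin (N + 1)) : Prop :=
  Monotone p ∧ ∀ t, ((p t).1 : ℕ) + ((p t).2 : ℕ) = t

/-- The predecessor of a time, and the first time itself if there is none. -/
def timeBefore (t : Fin (M + N + 1)) : Fin (M + N + 1) := ⟨t - 1, by omega⟩

/-- The successor of a time, and the last time itself if there is none. -/
def timeAfter (t : Fin (M + N + 1)) : Fin (M + N + 1) := ⟨min (t + 1) (M + N), by omega⟩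

/-- The path `p` turns at time `t`. -/
def IsTurn (p : Fin (M + N + 1) → Fin (M + 1) × Fin (N + 1)) (t : Fin (M + N + 1)) : Prop :=
  (p (timeBefore t)).1 < (p (timeAfter t)).1 ∧ (p (timeBefore t)).2 < (p (timeAfter t)).2

/-- The point opposite to `p t` in the square spanned by the neighbours of `p t` on the path. -/
def oppositePoint (p : Fin (M + N + 1) → Fin (M + 1) × Fin (N + 1)) (t : Fin (M + N + 1)) :
    Fin (M + 1) × Fin (N + 1) :=
  (if (p t).1 = (p (timeBefore t)).1 then (p (timeAfter t)).1 else (p (timeBefore t)).1,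
    if (p t).2 = (p (timeBefore t)).2 then (p (timeAfter t)).2 else (p (timeBefore t)).2)

/-- The path obtained by flipping a corner. -/
def flipPath (p : Fin (M + N + 1) → Fin (M + 1) × Fin (N + 1)) (t : Fin (M + N + 1)) :
    Fin (M + N + 1) → Fin (M + 1) × Fin (N + 1) :=
  Function.update p t (oppositePoint p t)

variable {p : Fin (M + N + 1) → Fin (M + 1) × Fin (N + 1)} {t : Fin (M + N + 1)}

theorem IsLatticePath.fst_le (hp : IsLatticePath p) {t t' : Fin (M + N + 1)} (h : t.1 ≤ t'.1) :
    ((p t).1 : ℕ) ≤ (p t').1 := (hp.1 (show t ≤ t' from h)).1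

theorem IsLatticePath.snd_le (hp : IsLatticePath p) {t t' : Fin (M + N + 1)} (h : t.1 ≤ t'.1) :
    ((p t).2 : ℕ) ≤ (p t').2 := (hp.1 (show t ≤ t' from h)).2

theorem IsLatticePath.last (hp : IsLatticePath p) :
    p (Fin.last (M + N)) = (Fin.last M, Fin.last N) := by
  have h := hp.2 (Fin.last (M + N))
  simp only [Fin.val_last] at h
  ext <;> simp only [Fin.val_last] <;> omega

/-- A discrete intermediate value argument, descending from the endpoint: each step changes the
coordinate by at most one. It later shows that a path covers every `α i`. -/
theorem IsLatticePath.exists_fst_eq (hp : IsLatticePath p) (i : Fin (M + 1)) :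
    ∃ t, (p t).1 = i := by
  have key : ∀ k (hk : k < M + N + 1), i ≤ (p ⟨k, hk⟩).1 → ∃ t, (p t).1 = i := by
    intro k
    induction k with
    | zero =>
      intro hk h
      have h0 := hp.2 ⟨0, hk⟩
      refine ⟨⟨0, hk⟩, Fin.ext ?_⟩
      have : (i : ℕ) ≤ _ := h
      simp only at h0
      omega
    | succ k ih =>
      intro hk h
      by_cases h' : (p ⟨k + 1, hk⟩).1 = i
      · exact ⟨_, h'⟩
      · apply ih (by omega)
        have h1 := hp.2 ⟨k + 1, hk⟩
        have h2 := hp.2 ⟨k, by omega⟩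
        have h3 := hp.snd_le (t := ⟨k, by omega⟩) (t' := ⟨k + 1, hk⟩) (by simp)
        have h4 : (i : ℕ) ≤ _ := h
        have h5 : ((p ⟨k + 1, hk⟩).1 : ℕ) ≠ i := fun e => h' (Fin.ext e)
        change (i : ℕ) ≤ _
        simp only at h1 h2
        omega
  exact key (M + N) (by omega) (by
    have := hp.last
    change i ≤ (p (Fin.last (M + N))).1
    rw [this]; exact Fin.le_last i)

theorem IsLatticePath.exists_snd_eq (hp : IsLatticePath p) (i : Fin (N + 1)) :
    ∃ t, (p t).2 = i := by
  have key : ∀ k (hk : k < M + N + 1), i ≤ (p ⟨k, hk⟩).2 → ∃ t, (p t).2 = i := by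
    intro k
    induction k with
    | zero =>
      intro hk h
      have h0 := hp.2 ⟨0, hk⟩
      refine ⟨⟨0, hk⟩, Fin.ext ?_⟩
      have : (i : ℕ) ≤ _ := h
      simp only at h0
      omega
    | succ k ih =>
      intro hk h
      by_cases h' : (p ⟨k + 1, hk⟩).2 = i
      · exact ⟨_, h'⟩
      · apply ih (by omega)
        have h1 := hp.2 ⟨k + 1, hk⟩
        have h2 := hp.2 ⟨k, by omega⟩
        have h3 := hp.fst_le (t := ⟨k, by omega⟩) (t' := ⟨k + 1, hk⟩) (by simp)
        have h4 : (i : ℕ) ≤ _ := h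
        have h5 : ((p ⟨k + 1, hk⟩).2 : ℕ) ≠ i := fun e => h' (Fin.ext e)
        change (i : ℕ) ≤ _
        simp only at h1 h2
        omega
  exact key (M + N) (by omega) (by
    have := hp.last
    change i ≤ (p (Fin.last (M + N))).2
    rw [this]; exact Fin.le_last i)

/-- Where the path does not turn, the steps around `p t` are parallel, so the coordinate along that
direction is attained only at time `t`. At the ends there is at most one step, because `timeBefore`
and `timeAfter` are truncated. -/
theorem IsLatticePath.fst_or_snd_ne_of_not_isTurn (hp : IsLatticePath p) (h : ¬ IsTurn p t) :
    (∀ t', t' ≠ t → (p t').1 ≠ (p t).1) ∨ (∀ t', t' ≠ t → (p t').2 ≠ (p t).2) := by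
  have hb1 := hp.fst_le (t := timeBefore t) (t' := t) (by simp [timeBefore])
  have hb2 := hp.snd_le (t := timeBefore t) (t' := t) (by simp [timeBefore])
  have ha1 := hp.fst_le (t := t) (t' := timeAfter t) (by simp [timeAfter]; omega)
  have ha2 := hp.snd_le (t := t) (t' := timeAfter t) (by simp [timeAfter]; omega)
  have s0 := hp.2 t
  have s1 := hp.2 (timeBefore t)
  have s2 := hp.2 (timeAfter t)
  have e1 : ((timeBefore t : Fin (M + N + 1)) : ℕ) = t - 1 := rfl
  have e2 : ((timeAfter t : Fin (M + N + 1)) : ℕ) = min ((t : ℕ) + 1) (M + N) := rfl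
  rw [IsTurn, Fin.lt_def, Fin.lt_def] at h
  by_cases h1 : ((p (timeBefore t)).1 : ℕ) < (p (timeAfter t)).1
  · left
    intro t' ht' e
    have e' : ((p t').1 : ℕ) = (p t).1 := congrArg Fin.val e
    have st := hp.2 t'
    have hne : (t' : ℕ) ≠ t := fun h => ht' (Fin.ext h)
    rcases lt_or_gt_of_ne hne with hlt | hlt
    · have := hp.fst_le (t := t') (t' := timeBefore t) (by omega)
      omega
    · have := hp.fst_le (t := timeAfter t) (t' := t') (by omega)
      omega
  · right
    intro t' ht' e
    have e' : ((p t').2 : ℕ) = (p t).2 := congrArg Fin.val e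
    have st := hp.2 t'
    have hne : (t' : ℕ) ≠ t := fun h => ht' (Fin.ext h)
    rcases lt_or_gt_of_ne hne with hlt | hlt
    · have := hp.snd_le (t := t') (t' := timeBefore t) (by omega)
      omega
    · have := hp.snd_le (t := timeAfter t) (t' := t') (by omega)
      omega

/-- A turn needs two steps, which excludes both ends of the path; the two neighbours then span a
unit square with `p t` and its opposite point as the other two corners. -/
theorem IsLatticePath.oppositePoint_val (hp : IsLatticePath p) (h : IsTurn p t) :
    0 < (t : ℕ) ∧ (t : ℕ) < M + N ∧
    ((oppositePoint p t).1 : ℕ) + (p t).1 = (p (timeBefore t)).1 + (p (timeAfter t)).1 ∧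
    ((oppositePoint p t).2 : ℕ) + (p t).2 = (p (timeBefore t)).2 + (p (timeAfter t)).2 ∧
    ((p (timeAfter t)).1 : ℕ) = (p (timeBefore t)).1 + 1 ∧
    ((p (timeAfter t)).2 : ℕ) = (p (timeBefore t)).2 + 1 := by
  have hb1 := hp.fst_le (t := timeBefore t) (t' := t) (by simp [timeBefore])
  have hb2 := hp.snd_le (t := timeBefore t) (t' := t) (by simp [timeBefore])
  have ha1 := hp.fst_le (t := t) (t' := timeAfter t) (by simp [timeAfter]; omega)
  have ha2 := hp.snd_le (t := t) (t' := timeAfter t) (by simp [timeAfter]; omega)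
  have s0 := hp.2 t
  have s1 := hp.2 (timeBefore t)
  have s2 := hp.2 (timeAfter t)
  have e1 : ((timeBefore t : Fin (M + N + 1)) : ℕ) = t - 1 := rfl
  have e2 : ((timeAfter t : Fin (M + N + 1)) : ℕ) = min ((t : ℕ) + 1) (M + N) := rfl
  rw [IsTurn, Fin.lt_def, Fin.lt_def] at h
  simp only [oppositePoint, Fin.ext_iff]
  refine ⟨by omega, by omega, ?_, ?_, by omega, by omega⟩ <;> split_ifs <;> omega

theorem timeBefore_ne (h : 0 < (t : ℕ)) : timeBefore t ≠ t := by
  intro e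
  have := congrArg Fin.val e
  simp only [timeBefore] at this
  omega

theorem timeAfter_ne (h : (t : ℕ) < M + N) : timeAfter t ≠ t := by
  intro e
  have := congrArg Fin.val e
  simp only [timeAfter] at this
  omega

theorem IsLatticePath.flipPath (hp : IsLatticePath p) (h : IsTurn p t) :
    IsLatticePath (flipPath p t) := by
  obtain ⟨h0, h1, o1, o2, a1, a2⟩ := hp.oppositePoint_val h
  have hb1 := hp.fst_le (t := timeBefore t) (t' := t) (by simp [timeBefore])
  have hb2 := hp.snd_le (t := timeBefore t) (t' := t) (by simp [timeBefore])
  have ha1 := hp.fst_le (t := t) (t' := timeAfter t) (by simp [timeAfter]; omega)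
  have ha2 := hp.snd_le (t := t) (t' := timeAfter t) (by simp [timeAfter]; omega)
  have s0 := hp.2 t
  have s1 := hp.2 (timeBefore t)
  have s2 := hp.2 (timeAfter t)
  have e1 : ((timeBefore t : Fin (M + N + 1)) : ℕ) = t - 1 := rfl
  have e2 : ((timeAfter t : Fin (M + N + 1)) : ℕ) = min ((t : ℕ) + 1) (M + N) := rfl
  constructor
  · intro x y hxy
    have hxy' : (x : ℕ) ≤ y := hxy
    by_cases hx : x = t <;> by_cases hy : y = t
    · rw [hx, hy]
    · subst hx
      have hne : (x : ℕ) ≠ y := fun e => hy (Fin.ext e.symm)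
      have := hp.fst_le (t := timeAfter x) (t' := y) (by omega)
      have := hp.snd_le (t := timeAfter x) (t' := y) (by omega)
      simp only [_root_.flipPath, Function.update_self, Function.update_of_ne hy]
      exact ⟨by rw [Fin.le_def]; omega, by rw [Fin.le_def]; omega⟩
    · subst hy
      have hne : (x : ℕ) ≠ y := fun e => hx (Fin.ext e)
      have := hp.fst_le (t := x) (t' := timeBefore y) (by omega)
      have := hp.snd_le (t := x) (t' := timeBefore y) (by omega)
      simp only [_root_.flipPath, Function.update_self, Function.update_of_ne hx]
      exact ⟨by rw [Fin.le_def]; omega, by rw [Fin.le_def]; omega⟩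
    · simp only [_root_.flipPath, Function.update_of_ne hx, Function.update_of_ne hy]
      exact hp.1 hxy
  · intro x
    by_cases hx : x = t
    · subst hx
      simp only [_root_.flipPath, Function.update_self]
      omega
    · simp only [_root_.flipPath, Function.update_of_ne hx]
      exact hp.2 x

theorem IsLatticePath.isTurn_flipPath (hp : IsLatticePath p) (h : IsTurn p t) :
    IsTurn (_root_.flipPath p t) t := by
  obtain ⟨h0, h1, -⟩ := hp.oppositePoint_val h
  simpa only [IsTurn, _root_.flipPath, Function.update_of_ne (timeBefore_ne h0),
    Function.update_of_ne (timeAfter_ne h1)] using h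

theorem IsLatticePath.flipPath_flipPath (hp : IsLatticePath p) (h : IsTurn p t) :
    _root_.flipPath (_root_.flipPath p t) t = p := by
  obtain ⟨h0, h1, o1, o2, a1, a2⟩ := hp.oppositePoint_val h
  obtain ⟨-, -, o1', o2', -, -⟩ := (hp.flipPath h).oppositePoint_val (hp.isTurn_flipPath h)
  simp only [_root_.flipPath, Function.update_of_ne (timeBefore_ne h0), Function.update_self,
    Function.update_of_ne (timeAfter_ne h1)] at o1' o2'
  rw [_root_.flipPath, _root_.flipPath, Function.update_idem, Function.update_eq_self_iff]
  refine Prod.ext (Fin.ext ?_) (Fin.ext ?_)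
  · omega
  · omega

/-- The sign of a path. -/
def pathSign (K : Type*) [Field K] (p : Fin (M + N + 1) → Fin (M + 1) × Fin (N + 1)) : K :=
  ∏ t, (-1) ^ ((p t).1 : ℕ)

theorem pathSign_mul_self (K : Type*) [Field K]
    (p : Fin (M + N + 1) → Fin (M + 1) × Fin (N + 1)) : pathSign K p * pathSign K p = 1 := by
  rw [pathSign, ← Finset.prod_mul_distrib]
  exact Finset.prod_eq_one fun t _ => by rw [← mul_pow]; simp

/-- A flip changes a single first coordinate, and the old and the new value have odd sum. -/
theorem IsLatticePath.pathSign_flipPath (K : Type*) [Field K] (hp : IsLatticePath p)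
    (h : IsTurn p t) : pathSign K (_root_.flipPath p t) = - pathSign K p := by
  obtain ⟨h0, h1, o1, o2, a1, a2⟩ := hp.oppositePoint_val h
  have : ∀ q : Fin (M + N + 1) → Fin (M + 1) × Fin (N + 1), pathSign K q =
      (-1) ^ ((q t).1 : ℕ) * ∏ x ∈ Finset.univ.erase t, (-1 : K) ^ ((q x).1 : ℕ) := fun q =>
    (Finset.mul_prod_erase Finset.univ _ (Finset.mem_univ t)).symm
  rw [this, this p, ← neg_mul]
  congr 1
  · rw [_root_.flipPath, Function.update_self]
    have h2 : (-1 : K) ^ (((oppositePoint p t).1 : ℕ) + (p t).1) = -1 := by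
      rw [o1, a1]
      exact Odd.neg_one_pow ⟨_, by ring⟩
    have h3 : (-1 : K) ^ ((p t).1 : ℕ) * (-1 : K) ^ ((p t).1 : ℕ) = 1 := by rw [← mul_pow]; simp
    rw [pow_add] at h2
    calc _ = (-1 : K) ^ ((oppositePoint p t).1 : ℕ) *
        ((-1 : K) ^ ((p t).1 : ℕ) * (-1 : K) ^ ((p t).1 : ℕ)) := by rw [h3, mul_one]
      _ = _ := by rw [← mul_assoc, h2, neg_one_mul]
  · refine Finset.prod_congr rfl fun x hx => ?_
    rw [_root_.flipPath, Function.update_of_ne (Finset.ne_of_mem_erase hx)]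

/-- The path that runs along the bottom row first. -/
def rowFirstPath (M N : ℕ) (t : Fin (M + N + 1)) : Fin (M + 1) × Fin (N + 1) :=
  (⟨min t M, by omega⟩, ⟨t - M, by omega⟩)

theorem isLatticePath_rowFirstPath : IsLatticePath (rowFirstPath M N) := by
  constructor
  · intro x y h
    have h' : (x : ℕ) ≤ y := h
    constructor
    · simp only [rowFirstPath, Fin.le_def]; omega
    · simp only [rowFirstPath, Fin.le_def]; omega
  · intro t
    simp only [rowFirstPath]
    omega

end LatticePath

/-! ### Orderings of generators that start with a complete bipartite graph -/

section Staircase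

theorem symbolDegree_apply {V : Type*} {μ : ℕ} (g : Fin μ → V →₀ ℕ) (τ : Finset (Fin μ)) (v : V) :
    symbolDegree g τ v = τ.sup fun l => g l v :=
  Finset.apply_sup_eq_sup_comp (fun f : V →₀ ℕ => f v) (fun _ _ => rfl) rfl

/-- Shrinking the symbol shrinks every tail lcm. Hence all faces of path symbols lie in the
Lyubeznik complex. -/
theorem LAdmissible.mono {V : Type*} {μ : ℕ} {g : Fin μ → V →₀ ℕ} {τ τ' : Finset (Fin μ)}
    (h : LAdmissible g τ') (hτ : τ ⊆ τ') : LAdmissible g τ := by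
  rintro l hl ⟨k, hk, hlk⟩ q hq hle
  refine h l (hτ hl) ⟨k, hτ hk, hlk⟩ q hq (hle.trans ?_)
  exact Finset.sup_mono (Finset.filter_subset_filter _ hτ)

theorem taylorDifferential_single (K : Type*) [Field K] {V : Type*} {μ : ℕ} (g : Fin μ → V →₀ ℕ)
    (τ : Finset (Fin μ)) :
    taylorDifferential K g (Finsupp.single τ 1) = ∑ l ∈ τ, Finsupp.single (τ.erase l)
      (MvPolynomial.monomial (symbolDegree g τ - symbolDegree g (τ.erase l))
        ((-1 : K) ^ (τ.filter (· < l)).card)) := by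
  rw [taylorDifferential, Finsupp.linearCombination_single, one_smul]

theorem monomial_mem_variablesIdeal {V K : Type*} [Field K] {u : V →₀ ℕ} (hu : u ≠ 0) (c : K) :
    MvPolynomial.monomial u c ∈ variablesIdeal V K := by
  obtain ⟨v, hv⟩ := Finsupp.ne_iff.1 hu
  have hle : Finsupp.single v 1 ≤ u := by
    rw [Finsupp.single_le_iff]
    exact Nat.one_le_iff_ne_zero.2 hv
  have : MvPolynomial.monomial u c =
      MvPolynomial.monomial (u - Finsupp.single v 1) c * MvPolynomial.X v := by
    rw [MvPolynomial.X, MvPolynomial.monomial_mul, mul_one, tsub_add_cancel_of_le hle]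
  rw [this]
  exact Ideal.mul_mem_left _ _ (Ideal.subset_span ⟨v, rfl⟩)

variable {V : Type*} {M N μ : ℕ}

/-- The sequence `g` starts with the edges `α i, β j` of a complete bipartite graph in
lexicographic order, and each later `g q` completes the last of these edges to a set of vertices
that contains a previous one. -/
structure IsStaircaseOrder (g : Fin μ → V →₀ ℕ) (c : Fin (M + 1) × Fin (N + 1) → Fin μ)
    (α : Fin (M + 1) → V) (β : Fin (N + 1) → V) : Prop where
  lt_iff : ∀ x y, c x < c y ↔ x.1 < y.1 ∨ x.1 = y.1 ∧ x.2 < y.2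
  lt_other : ∀ q, q ∉ Set.range c → ∀ x, c x < q
  map_cross : ∀ x, g (c x) = Finsupp.single (α x.1) 1 + Finsupp.single (β x.2) 1
  left_injective : Function.Injective α
  right_injective : Function.Injective β
  left_ne_right : ∀ i j, α i ≠ β j
  cover : ∀ v, (∃ i, α i = v) ∨ ∃ j, β j = v
  map_other : ∀ q, q ∉ Set.range c → ∃ x, c x < c (Fin.last M, Fin.last N) ∧
    g (c x) ≤ g (c (Fin.last M, Fin.last N)) ⊔ g q

namespace IsStaircaseOrder

variable {g : Fin μ → V →₀ ℕ} {c : Fin (M + 1) × Fin (N + 1) → Fin μ} {α : Fin (M + 1) → V}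
  {β : Fin (N + 1) → V} (hg : IsStaircaseOrder g c α β)
  {p : Fin (M + N + 1) → Fin (M + 1) × Fin (N + 1)}

include hg

theorem map_cross_left (x : Fin (M + 1) × Fin (N + 1)) (i : Fin (M + 1)) :
    g (c x) (α i) = if x.1 = i then 1 else 0 := by
  classical
  rw [hg.map_cross, Finsupp.add_apply, Finsupp.single_apply, Finsupp.single_apply,
    if_neg (hg.left_ne_right i x.2).symm, add_zero]
  simp only [hg.left_injective.eq_iff]

theorem map_cross_right (x : Fin (M + 1) × Fin (N + 1)) (j : Fin (N + 1)) :
    g (c x) (β j) = if x.2 = j then 1 else 0 := by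
  classical
  rw [hg.map_cross, Finsupp.add_apply, Finsupp.single_apply, Finsupp.single_apply,
    if_neg (hg.left_ne_right x.1 j), zero_add]
  simp only [hg.right_injective.eq_iff]

theorem cross_le_sup (x y : Fin (M + 1) × Fin (N + 1)) :
    g (c (x.1, y.2)) ≤ g (c x) ⊔ g (c y) := by
  intro v
  rw [Finsupp.sup_apply]
  rcases hg.cover v with ⟨i, rfl⟩ | ⟨j, rfl⟩
  · simp only [hg.map_cross_left]
    exact le_sup_left
  · simp only [hg.map_cross_right]
    exact le_sup_right

/-- Along a path both coordinates are monotone and their sum strictly increases, so the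
lexicographic position strictly increases. -/
theorem cross_strictMono (hp : IsLatticePath p) : StrictMono fun t => c (p t) := by
  intro t t' h
  have h' : (t : ℕ) < t' := h
  have h1 := hp.fst_le h'.le
  have h2 := hp.2 t
  have h3 := hp.2 t'
  simp only [hg.lt_iff, Fin.lt_def, Fin.ext_iff]
  omega

theorem injective : Function.Injective c := by
  intro x y h
  have h1 := (hg.lt_iff x y).not.1 (by rw [h]; exact lt_irrefl _)
  have h2 := (hg.lt_iff y x).not.1 (by rw [h]; exact lt_irrefl _)
  simp only [Fin.lt_def, Fin.ext_iff] at h1 h2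
  exact Prod.ext (Fin.ext (by omega)) (Fin.ext (by omega))

theorem erase_image (hp : IsLatticePath p) (t : Fin (M + N + 1)) :
    (Finset.univ.image fun t => c (p t)).erase (c (p t)) =
      (Finset.univ.erase t).image fun t => c (p t) :=
  (Finset.image_erase (hg.cross_strictMono hp).injective _ _).symm

theorem symbolDegree_left (hp : IsLatticePath p) (i : Fin (M + 1)) :
    symbolDegree g (Finset.univ.image fun t => c (p t)) (α i) = 1 := by
  rw [symbolDegree_apply]
  apply le_antisymm
  · apply Finset.sup_le
    intro l hl
    obtain ⟨t, -, rfl⟩ := Finset.mem_image.1 hl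
    rw [hg.map_cross_left]
    split_ifs <;> simp
  · obtain ⟨t, ht⟩ := hp.exists_fst_eq i
    refine le_trans ?_ (Finset.le_sup (f := fun l => g l (α i))
      (Finset.mem_image_of_mem (fun t => c (p t)) (Finset.mem_univ t)))
    simp only [hg.map_cross_left, ht, if_true, le_refl]

theorem symbolDegree_right (hp : IsLatticePath p) (j : Fin (N + 1)) :
    symbolDegree g (Finset.univ.image fun t => c (p t)) (β j) = 1 := by
  rw [symbolDegree_apply]
  apply le_antisymm
  · apply Finset.sup_le
    intro l hl
    obtain ⟨t, -, rfl⟩ := Finset.mem_image.1 hl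
    rw [hg.map_cross_right]
    split_ifs <;> simp
  · obtain ⟨t, ht⟩ := hp.exists_snd_eq j
    refine le_trans ?_ (Finset.le_sup (f := fun l => g l (β j))
      (Finset.mem_image_of_mem (fun t => c (p t)) (Finset.mem_univ t)))
    simp only [hg.map_cross_right, ht, if_true, le_refl]

theorem symbolDegree_path [Fintype V] (hp : IsLatticePath p) :
    symbolDegree g (Finset.univ.image fun t => c (p t)) = zeroOneVector Finset.univ := by
  classical
  ext v
  have h1 : zeroOneVector (Finset.univ : Finset V) v = 1 := by
    simp [zeroOneVector, Finsupp.finsetSum_apply, Finsupp.single_apply]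
  rw [h1]
  rcases hg.cover v with ⟨i, rfl⟩ | ⟨j, rfl⟩
  · exact hg.symbolDegree_left hp i
  · exact hg.symbolDegree_right hp j

/-- A point that is not a turn is alone in its row or column, so its deletion uncovers the vertex `α
(p t).1` or `β (p t).2`. -/
theorem symbolDegree_erase_ne (hp : IsLatticePath p) {t : Fin (M + N + 1)} (ht : ¬ IsTurn p t) :
    symbolDegree g (Finset.univ.image fun t => c (p t)) -
      symbolDegree g ((Finset.univ.image fun t => c (p t)).erase (c (p t))) ≠ 0 := by
  rw [hg.erase_image hp]
  intro h0
  rcases hp.fst_or_snd_ne_of_not_isTurn ht with h | h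
  · have h1 := DFunLike.congr_fun h0 (α (p t).1)
    rw [Finsupp.tsub_apply, hg.symbolDegree_left hp, symbolDegree_apply] at h1
    rw [Finset.sup_eq_bot_iff _ _ |>.2] at h1
    · simp at h1
    · intro l hl
      obtain ⟨t', ht', rfl⟩ := Finset.mem_image.1 hl
      rw [hg.map_cross_left, if_neg (h t' (Finset.ne_of_mem_erase ht'))]
      rfl
  · have h1 := DFunLike.congr_fun h0 (β (p t).2)
    rw [Finsupp.tsub_apply, hg.symbolDegree_right hp, symbolDegree_apply] at h1
    rw [Finset.sup_eq_bot_iff _ _ |>.2] at h1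
    · simp at h1
    · intro l hl
      obtain ⟨t', ht', rfl⟩ := Finset.mem_image.1 hl
      rw [hg.map_cross_right, if_neg (h t' (Finset.ne_of_mem_erase ht'))]
      rfl

/-- From time `t` on, the path stays weakly above `p t` in both coordinates. A generator dividing a
tail lcm takes each of its two vertices from such a point, so it cannot precede `c (p t)`. -/
theorem lAdmissible_path (hp : IsLatticePath p) :
    LAdmissible g (Finset.univ.image fun t => c (p t)) := by
  intro l hl _ q hq hle
  obtain ⟨t, -, rfl⟩ := Finset.mem_image.1 hl
  have hqr : q ∈ Set.range c := by
    by_contra h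
    exact absurd hq (hg.lt_other q h (p t)).not_gt
  obtain ⟨x, rfl⟩ := hqr
  have key : ∀ v, g (c x) v = 1 → ∃ t', t ≤ t' ∧ 1 ≤ g (c (p t')) v := by
    intro v hv
    have h1 : 1 ≤ symbolDegree g _ v := hv ▸ hle v
    rw [symbolDegree_apply, Finset.le_sup_iff (by simp)] at h1
    obtain ⟨l, hl, h2⟩ := h1
    obtain ⟨hl1, hl2⟩ := Finset.mem_filter.1 hl
    obtain ⟨t', -, rfl⟩ := Finset.mem_image.1 hl1
    exact ⟨t', (hg.cross_strictMono hp).le_iff_le.1 hl2, h2⟩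
  obtain ⟨t1, ht1, h1⟩ := key (α x.1) (by rw [hg.map_cross_left, if_pos rfl])
  obtain ⟨t2, ht2, h2⟩ := key (β x.2) (by rw [hg.map_cross_right, if_pos rfl])
  rw [hg.map_cross_left] at h1
  rw [hg.map_cross_right] at h2
  have e1 : (p t1).1 = x.1 := by by_contra h; simp [h] at h1
  have e2 : (p t2).2 = x.2 := by by_contra h; simp [h] at h2
  have l1 := (hp.1 ht1).1
  have l2 := (hp.1 ht2).2
  rw [e1] at l1
  rw [e2] at l2
  rcases (hg.lt_iff _ _).1 hq with h | ⟨-, h⟩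
  · exact absurd h l1.not_gt
  · exact absurd h l2.not_gt

/-- A further cross edge is incomparable to the path point on its antidiagonal, and the two together
cover an earlier cross edge. A further edge of another kind clashes in the same way with the last
point of the path, by `map_other`. -/
theorem isMaximalLAdmissible_path (hp : IsLatticePath p) :
    IsMaximalLAdmissible g (Finset.univ.image fun t => c (p t)) := by
  refine ⟨hg.lAdmissible_path hp, fun τ' hτ hadm => ?_⟩
  obtain ⟨hsub, hne⟩ := Finset.ssubset_iff_subset_ne.1 hτ
  obtain ⟨q, hq, hqn⟩ := Finset.exists_of_ssubset hτ
  have mem : ∀ t, c (p t) ∈ τ' := fun t =>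
    hsub (Finset.mem_image_of_mem (fun t => c (p t)) (Finset.mem_univ t))
  by_cases hqr : q ∈ Set.range c
  · obtain ⟨x, rfl⟩ := hqr
    have hlt : (x.1 : ℕ) + x.2 < M + N + 1 := by omega
    -- The path meets each antidiagonal exactly once; this is the time at which it meets that of
    -- `x`.
    set t : Fin (M + N + 1) := ⟨(x.1 : ℕ) + x.2, hlt⟩ with ht
    have hsum := hp.2 t
    have hxt : x ≠ p t := by
      rintro e
      exact hqn (e ▸ Finset.mem_image_of_mem (fun t => c (p t)) (Finset.mem_univ t))
    have hval : ((t : Fin (M + N + 1)) : ℕ) = (x.1 : ℕ) + x.2 := rfl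
    have hx1 : (x.1 : ℕ) ≠ (p t).1 := fun e =>
      hxt (Prod.ext (Fin.ext e) (Fin.ext (by omega)))
    rcases lt_or_gt_of_ne hx1 with h | h
    · have hlt : c x < c (p t) := (hg.lt_iff _ _).2 (Or.inl h)
      refine hadm (c x) hq ⟨c (p t), mem t, hlt⟩ (c (x.1, (p t).2))
        ((hg.lt_iff _ _).2 (Or.inr ⟨rfl, by simp only [Fin.lt_def]; omega⟩))
        ((hg.cross_le_sup x (p t)).trans (sup_le ?_ ?_))
      · exact Finset.le_sup (f := g) (Finset.mem_filter.2 ⟨hq, le_rfl⟩)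
      · exact Finset.le_sup (f := g) (Finset.mem_filter.2 ⟨mem t, hlt.le⟩)
    · have hlt : c (p t) < c x := (hg.lt_iff _ _).2 (Or.inl h)
      refine hadm (c (p t)) (mem t) ⟨c x, hq, hlt⟩ (c ((p t).1, x.2))
        ((hg.lt_iff _ _).2 (Or.inr ⟨rfl, by simp only [Fin.lt_def]; omega⟩))
        ((hg.cross_le_sup (p t) x).trans (sup_le ?_ ?_))
      · exact Finset.le_sup (f := g) (Finset.mem_filter.2 ⟨mem t, le_rfl⟩)
      · exact Finset.le_sup (f := g) (Finset.mem_filter.2 ⟨hq, hlt.le⟩)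
  · obtain ⟨x, hx, hle⟩ := hg.map_other q hqr
    have hm := mem (Fin.last _)
    rw [hp.last] at hm
    have hlt := hg.lt_other q hqr (Fin.last M, Fin.last N)
    refine hadm _ hm ⟨q, hq, hlt⟩ _ hx (hle.trans (sup_le ?_ ?_))
    · exact Finset.le_sup (f := g) (Finset.mem_filter.2 ⟨hm, le_rfl⟩)
    · exact Finset.le_sup (f := g) (Finset.mem_filter.2 ⟨hq, hlt.le⟩)

theorem card_path (hp : IsLatticePath p) :
    (Finset.univ.image fun t => c (p t)).card = M + N + 1 := by
  rw [Finset.card_image_of_injective _ (hg.cross_strictMono hp).injective, Finset.card_univ,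
    Fintype.card_fin]

theorem path_injective {p' : Fin (M + N + 1) → Fin (M + 1) × Fin (N + 1)} (hp : IsLatticePath p)
    (hp' : IsLatticePath p')
    (h : (Finset.univ.image fun t => c (p t)) = Finset.univ.image fun t => c (p' t)) :
    p = p' := by
  funext t
  have h1 : c (p t) ∈ Finset.univ.image fun t => c (p' t) :=
    h ▸ Finset.mem_image_of_mem (fun t => c (p t)) (Finset.mem_univ t)
  obtain ⟨t', -, ht'⟩ := Finset.mem_image.1 h1
  have h2 := hg.injective ht'
  have h3 := hp.2 t
  rw [← h2, hp'.2 t'] at h3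
  rw [← h2, Fin.ext h3]

/-- By monotonicity exactly `t` indices of the symbol precede `c (p t)`, so the Taylor sign is `(-1)
^ t`. -/
theorem taylorDifferential_path (K : Type*) [Field K] (hp : IsLatticePath p) :
    taylorDifferential K g (Finsupp.single (Finset.univ.image fun t => c (p t)) (1 : MvPolynomial V K)) =
      ∑ t, Finsupp.single ((Finset.univ.image fun t => c (p t)).erase (c (p t)))
        (MvPolynomial.monomial (symbolDegree g (Finset.univ.image fun t => c (p t)) -
          symbolDegree g ((Finset.univ.image fun t => c (p t)).erase (c (p t))))
          ((-1 : K) ^ (t : ℕ))) := by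
  rw [taylorDifferential_single, Finset.sum_image (hg.cross_strictMono hp).injective.injOn]
  refine Finset.sum_congr rfl fun t _ => ?_
  have : ((Finset.univ.image fun t => c (p t)).filter (· < c (p t))).card = (t : ℕ) := by
    rw [Finset.filter_image, Finset.card_image_of_injective _ (hg.cross_strictMono hp).injective]
    simp only [(hg.cross_strictMono hp).lt_iff_lt]
    rw [Finset.filter_gt_eq_Iio, Fin.card_Iio]
  rw [this]

-- The summands are indexed by pairs of a path and a time. Those at turns cancel under corner
-- flipping; each of the others already has its coefficient in `𝔪`.
open scoped Classical in
theorem taylorDifferential_sum_path_mem [Fintype V] (K : Type*) [Field K] :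
    taylorDifferential K g (∑ p ∈ Finset.univ.filter (IsLatticePath (M := M) (N := N)),
      MvPolynomial.C (σ := V) (pathSign K p) • Finsupp.single (Finset.univ.image fun t => c (p t)) (1 : MvPolynomial V K)) ∈
      variablesIdeal V K • lyubeznik K g (M + N) := by
  set F : (Fin (M + N + 1) → Fin (M + 1) × Fin (N + 1)) → Fin (M + N + 1) →
      (Finset (Fin μ) →₀ MvPolynomial V K) := fun p t =>
    Finsupp.single ((Finset.univ.image fun t => c (p t)).erase (c (p t)))
        (MvPolynomial.C (σ := V) (pathSign K p) *
          MvPolynomial.monomial (symbolDegree g (Finset.univ.image fun t => c (p t)) -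
          symbolDegree g ((Finset.univ.image fun t => c (p t)).erase (c (p t))))
          ((-1 : K) ^ (t : ℕ))) with hF
  have h1 : taylorDifferential K g (∑ p ∈ Finset.univ.filter (IsLatticePath (M := M) (N := N)),
      MvPolynomial.C (σ := V) (pathSign K p) • Finsupp.single (Finset.univ.image fun t => c (p t)) (1 : MvPolynomial V K)) =
      ∑ x ∈ (Finset.univ.filter (IsLatticePath (M := M) (N := N))) ×ˢ Finset.univ, F x.1 x.2 := by
    rw [map_sum, Finset.sum_product]
    refine Finset.sum_congr rfl fun p hp => ?_
    rw [map_smul, hg.taylorDifferential_path K (Finset.mem_filter.1 hp).2, Finset.smul_sum]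
    refine Finset.sum_congr rfl fun t _ => ?_
    rw [hF, Finsupp.smul_single, smul_eq_mul]
  rw [h1, ← Finset.sum_filter_add_sum_filter_not _ (fun x => IsTurn x.1 x.2)]
  refine Submodule.add_mem _ ?_ (Submodule.sum_mem _ ?_)
  · convert Submodule.zero_mem _
    refine Finset.sum_involution (fun x _ => (flipPath x.1 x.2, x.2)) ?_ ?_ ?_ ?_
    · rintro ⟨p, t⟩ h
      simp only [Finset.mem_filter, Finset.mem_product, Finset.mem_univ, true_and, and_true] at h
      obtain ⟨hp, ht⟩ := h
      have e : (Finset.univ.image fun s => c (flipPath p t s)).erase (c (flipPath p t t)) =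
          (Finset.univ.image fun s => c (p s)).erase (c (p t)) := by
        rw [hg.erase_image hp, hg.erase_image (hp.flipPath ht)]
        refine Finset.image_congr fun s hs => ?_
        rw [flipPath, Function.update_of_ne (Finset.ne_of_mem_erase hs)]
      simp only [hF]
      -- Both symbols have multidegree `V` and lose the same position `t`, so the terms on the
      -- common face differ only by the path sign.
      rw [e, hg.symbolDegree_path hp, hg.symbolDegree_path (hp.flipPath ht),
        hp.pathSign_flipPath K ht, ← Finsupp.single_add, map_neg, neg_mul, add_neg_cancel,
        Finsupp.single_zero]
    · rintro ⟨p, t⟩ h hne e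
      simp only [Finset.mem_filter, Finset.mem_product, Finset.mem_univ, true_and, and_true] at h
      obtain ⟨hp, ht⟩ := h
      have e1 := congrFun (congrArg Prod.fst e) t
      obtain ⟨-, -, o1, o2, a1, -⟩ := hp.oppositePoint_val ht
      simp only [flipPath, Function.update_self] at e1
      rw [e1] at o1
      omega
    · rintro ⟨p, t⟩ h
      simp only [Finset.mem_filter, Finset.mem_product, Finset.mem_univ, true_and, and_true] at h ⊢
      exact ⟨h.1.flipPath h.2, h.1.isTurn_flipPath h.2⟩
    · rintro ⟨p, t⟩ h
      simp only [Finset.mem_filter, Finset.mem_product, Finset.mem_univ, true_and, and_true] at h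
      simp only [h.1.flipPath_flipPath h.2]
  · rintro ⟨p, t⟩ h
    simp only [Finset.mem_filter, Finset.mem_product, Finset.mem_univ, true_and, and_true] at h
    obtain ⟨hp, ht⟩ := h
    simp only [hF]
    rw [← mul_one (MvPolynomial.C _ * _), ← smul_eq_mul, ← Finsupp.smul_single]
    refine Submodule.smul_mem_smul (Ideal.mul_mem_left _ _
      (monomial_mem_variablesIdeal (hg.symbolDegree_erase_ne hp ht) _)) (Submodule.subset_span ?_)
    refine ⟨_, (hg.lAdmissible_path hp).mono (Finset.erase_subset _ _), ?_, rfl⟩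
    rw [Finset.card_erase_of_mem (Finset.mem_image_of_mem (fun t => c (p t)) (Finset.mem_univ t)),
      hg.card_path hp, Nat.add_sub_cancel]

theorem hasMaximalCycle [Fintype V] (K : Type*) [Field K] :
    HasMaximalCycle K g (M + N + 1) (zeroOneVector Finset.univ) := by
  classical
  set sym : (Fin (M + N + 1) → Fin (M + 1) × Fin (N + 1)) → Finset (Fin μ) := fun p =>
    Finset.univ.image fun t => c (p t) with hsym
  set P := Finset.univ.filter (IsLatticePath (M := M) (N := N)) with hP
  set p₀ := rowFirstPath M N with hp₀
  have h₀ : IsLatticePath p₀ := isLatticePath_rowFirstPath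
  -- The factor `pathSign K p₀` normalises the coefficient of `e_τ` to `1`. Symbols that do not come
  -- from a path get coefficient `0`.
  set a : Finset (Fin μ) → MvPolynomial V K := fun τ =>
    ∑ p ∈ P, if sym p = τ then MvPolynomial.C (σ := V) (pathSign K p₀ * pathSign K p) else 0 with ha
  refine ⟨sym p₀, a, hg.isMaximalLAdmissible_path h₀, hg.card_path h₀, hg.symbolDegree_path h₀, ?_⟩
  have ha₀ : a (sym p₀) = 1 := by
    rw [ha]
    simp only
    rw [Finset.sum_eq_single p₀]
    · rw [if_pos rfl, pathSign_mul_self, map_one]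
    · intro p hp hne
      rw [if_neg]
      intro h
      exact hne (hg.path_injective (Finset.mem_filter.1 hp).2 h₀ h)
    · intro h
      exact absurd (Finset.mem_filter.2 ⟨Finset.mem_univ _, h₀⟩) h
  have key : Finsupp.single (sym p₀) 1 + ∑ τ' ∈ Finset.univ.filter
      (fun τ' => LAdmissible g τ' ∧ τ'.card = M + N + 1 ∧ τ' ≠ sym p₀),
        a τ' • Finsupp.single τ' (1 : MvPolynomial V K) =
      MvPolynomial.C (σ := V) (pathSign K p₀) •
        ∑ p ∈ P, MvPolynomial.C (σ := V) (pathSign K p) • Finsupp.single (sym p) (1 : MvPolynomial V K) := by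
    have e1 : Finsupp.single (sym p₀) (1 : MvPolynomial V K) =
        a (sym p₀) • Finsupp.single (sym p₀) 1 := by rw [ha₀, one_smul]
    have e2 : Finset.univ.filter
      (fun τ' => LAdmissible g τ' ∧ τ'.card = M + N + 1 ∧ τ' ≠ sym p₀) = (Finset.univ.filter
      (fun τ' => LAdmissible g τ' ∧ τ'.card = M + N + 1)).erase (sym p₀) := by
      ext τ
      simp only [Finset.mem_filter, Finset.mem_erase, Finset.mem_univ, true_and]
      tauto
    rw [e2, e1, Finset.add_sum_erase _ (fun τ' => a τ' • Finsupp.single τ' (1 : MvPolynomial V K))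
      (Finset.mem_filter.2 ⟨Finset.mem_univ _, hg.lAdmissible_path h₀, hg.card_path h₀⟩)]
    simp only [ha, Finset.sum_smul, Finset.smul_sum]
    rw [Finset.sum_comm]
    refine Finset.sum_congr rfl fun p hp => ?_
    have hp := (Finset.mem_filter.1 hp).2
    rw [Finset.sum_eq_single (sym p)]
    · rw [if_pos rfl, map_mul, mul_smul]
    · intro τ _ hne
      rw [if_neg hne.symm, zero_smul]
    · intro h
      exact absurd (Finset.mem_filter.2
        ⟨Finset.mem_univ _, hg.lAdmissible_path hp, hg.card_path hp⟩) h
  rw [show M + N + 1 - 1 = M + N from rfl]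
  convert Submodule.smul_mem _ (MvPolynomial.C (σ := V) (pathSign K p₀))
    (hg.taylorDifferential_sum_path_mem K) using 1
  rw [← map_smul]
  congr 1

end IsStaircaseOrder

end Staircase

/-! ### The minimal generators of an edge ideal -/

section EdgeIdeal

variable {V : Type*} (K : Type*) [Field K] (G : SimpleGraph V)

theorem mem_edgeIdeal_iff (p : MvPolynomial V K) :
    p ∈ edgeIdeal K G ↔ ∀ w ∈ p.support,
      ∃ u v, G.Adj u v ∧ Finsupp.single u 1 + Finsupp.single v 1 ≤ w := by
  have h : edgeIdeal K G = Ideal.span ((fun s => MvPolynomial.monomial s (1 : K)) ''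
      {e | ∃ u v, G.Adj u v ∧ e = Finsupp.single u 1 + Finsupp.single v 1}) := by
    rw [edgeIdeal]
    congr 1
    ext p
    constructor
    · rintro ⟨u, v, h, rfl⟩
      refine ⟨_, ⟨u, v, h, rfl⟩, ?_⟩
      simp [MvPolynomial.X, MvPolynomial.monomial_mul]
    · rintro ⟨_, ⟨u, v, h, rfl⟩, rfl⟩
      refine ⟨u, v, h, ?_⟩
      simp [MvPolynomial.X, MvPolynomial.monomial_mul]
  rw [h, MvPolynomial.mem_ideal_span_monomial_image]
  refine forall₂_congr fun w _ => ?_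
  constructor
  · rintro ⟨_, ⟨u, v, huv, rfl⟩, hle⟩
    exact ⟨u, v, huv, hle⟩
  · rintro ⟨u, v, huv, hle⟩
    exact ⟨_, ⟨u, v, huv, rfl⟩, hle⟩

theorem monomial_mem_edgeIdeal_iff (b : V →₀ ℕ) :
    MvPolynomial.monomial b (1 : K) ∈ edgeIdeal K G ↔
      ∃ u v, G.Adj u v ∧ Finsupp.single u 1 + Finsupp.single v 1 ≤ b := by
  classical
  rw [mem_edgeIdeal_iff, MvPolynomial.support_monomial, if_neg one_ne_zero]
  simp only [Finset.mem_singleton, forall_eq]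

theorem monomial_mem_edgeIdeal_of_mem_support {p : MvPolynomial V K} (hp : p ∈ edgeIdeal K G)
    {u : V →₀ ℕ} (hu : u ∈ p.support) : MvPolynomial.monomial u (1 : K) ∈ edgeIdeal K G :=
  (monomial_mem_edgeIdeal_iff K G u).2 ((mem_edgeIdeal_iff K G p).1 hp u hu)

/-- All edge monomials have total degree two, so none properly divides another. -/
theorem mem_minimalMonomialGenerators_edgeIdeal_iff (e : V →₀ ℕ) :
    e ∈ minimalMonomialGenerators (edgeIdeal K G) ↔
      ∃ u v, G.Adj u v ∧ e = Finsupp.single u 1 + Finsupp.single v 1 := by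
  have hdeg : ∀ a b : V →₀ ℕ, a.degree = 2 → b.degree = 2 → a ≤ b → a = b := by
    intro a b ha hb hab
    obtain ⟨c, rfl⟩ := exists_add_of_le hab
    rw [map_add] at hb
    have : c = 0 := by
      rw [← Finsupp.degree_eq_zero_iff]
      omega
    rw [this, add_zero]
  have hd : ∀ u v : V, (Finsupp.single u 1 + Finsupp.single v 1 : V →₀ ℕ).degree = 2 := by
    intro u v
    rw [map_add, Finsupp.degree_single, Finsupp.degree_single]
  constructor
  · intro h
    obtain ⟨u, v, huv, hle⟩ := (monomial_mem_edgeIdeal_iff K G e).1 h.1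
    exact ⟨u, v, huv, le_antisymm (h.2 ((monomial_mem_edgeIdeal_iff K G _).2
      ⟨u, v, huv, le_rfl⟩) hle) hle⟩
  · rintro ⟨u, v, huv, rfl⟩
    refine ⟨(monomial_mem_edgeIdeal_iff K G _).2 ⟨u, v, huv, le_rfl⟩, fun b hb hle => ?_⟩
    obtain ⟨u', v', -, hle'⟩ := (monomial_mem_edgeIdeal_iff K G b).1 hb
    rw [← hdeg _ _ (hd u' v') (hd u v) (hle'.trans hle)]
    exact hle'

theorem finite_minimalMonomialGenerators_edgeIdeal [Finite V] :
    (minimalMonomialGenerators (edgeIdeal K G)).Finite := by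
  refine (Set.finite_range fun x : V × V =>
    (Finsupp.single x.1 1 + Finsupp.single x.2 1 : V →₀ ℕ)).subset ?_
  intro e he
  obtain ⟨u, v, -, rfl⟩ := (mem_minimalMonomialGenerators_edgeIdeal_iff K G e).1 he
  exact ⟨(u, v), rfl⟩

/-- The bipartition of a complete bipartite spanning subgraph. -/
theorem HasSpanningCompleteBipartite.exists_parts {G : SimpleGraph V} {m n : ℕ}
    (h : HasSpanningCompleteBipartite G m n) :
    ∃ (α : Fin m → V) (β : Fin n → V), Function.Injective α ∧ Function.Injective β ∧
      (∀ i j, α i ≠ β j) ∧ (∀ v, (∃ i, α i = v) ∨ ∃ j, β j = v) ∧ (∀ i j, G.Adj (α i) (β j)) := by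
  obtain ⟨B, hB, ⟨φ⟩⟩ := h
  refine ⟨fun i => φ.symm (Sum.inl i), fun j => φ.symm (Sum.inr j), ?_, ?_, ?_, ?_, ?_⟩
  · exact φ.symm.injective.comp Sum.inl_injective
  · exact φ.symm.injective.comp Sum.inr_injective
  · intro i j h
    exact Sum.inl_ne_inr (φ.symm.injective h)
  · intro v
    rcases h : φ v with i | j
    · exact Or.inl ⟨i, by simp only [← h, RelIso.symm_apply_apply]⟩
    · exact Or.inr ⟨j, by simp only [← h, RelIso.symm_apply_apply]⟩
  · intro i j
    exact hB (φ.symm.map_adj_iff.2 (by simp))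

/-- The cross edges are numbered through `finProdFinEquiv`, which is lexicographic, and the
remaining generators are appended in an arbitrary order. -/
theorem exists_isStaircaseOrder [Finite V] {M N : ℕ} {α : Fin (M + 1) → V} {β : Fin (N + 1) → V}
    (hα : Function.Injective α) (hβ : Function.Injective β) (hαβ : ∀ i j, α i ≠ β j)
    (hcover : ∀ v, (∃ i, α i = v) ∨ ∃ j, β j = v) (hadj : ∀ i j, G.Adj (α i) (β j)) :
    ∃ (μ : ℕ) (g : Fin μ ≃ minimalMonomialGenerators (edgeIdeal K G))
      (c : Fin (M + 1) × Fin (N + 1) → Fin μ),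
      IsStaircaseOrder (fun l => (g l : V →₀ ℕ)) c α β := by
  classical
  have := (finite_minimalMonomialGenerators_edgeIdeal K G).to_subtype
  let cross : Fin (M + 1) × Fin (N + 1) → minimalMonomialGenerators (edgeIdeal K G) := fun x =>
    ⟨Finsupp.single (α x.1) 1 + Finsupp.single (β x.2) 1,
      (mem_minimalMonomialGenerators_edgeIdeal_iff K G _).2 ⟨_, _, hadj x.1 x.2, rfl⟩⟩
  have hcross : Function.Injective cross := by
    intro x y h
    have h' : (Finsupp.single (α x.1) 1 + Finsupp.single (β x.2) 1 : V →₀ ℕ) =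
      Finsupp.single (α y.1) 1 + Finsupp.single (β y.2) 1 := congrArg Subtype.val h
    have h1 := DFunLike.congr_fun h' (α x.1)
    have h2 := DFunLike.congr_fun h' (β x.2)
    simp only [Finsupp.add_apply, Finsupp.single_apply, hα.eq_iff, hβ.eq_iff, hαβ,
      (hαβ _ _).symm, if_false, if_true, add_zero, zero_add] at h1 h2
    refine Prod.ext ?_ ?_
    · by_contra hne
      simp [Ne.symm hne] at h1
    · by_contra hne
      simp [Ne.symm hne] at h2
  obtain ⟨k, ⟨ρ⟩⟩ := Finite.exists_equiv_fin ((Set.range cross)ᶜ : Set _)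
  let g : Fin ((M + 1) * (N + 1) + k) ≃ minimalMonomialGenerators (edgeIdeal K G) :=
    finSumFinEquiv.symm.trans ((Equiv.sumCongr
      (finProdFinEquiv.symm.trans (Equiv.ofInjective cross hcross)) ρ.symm).trans
        (Equiv.Set.sumCompl (Set.range cross)))
  let c : Fin (M + 1) × Fin (N + 1) → Fin ((M + 1) * (N + 1) + k) := fun x =>
    Fin.castAdd k (finProdFinEquiv x)
  have hgc : ∀ x, g (c x) = cross x := by
    intro x
    simp [g, c]
  have hc : ∀ x, (c x : ℕ) = (x.2 : ℕ) + (N + 1) * x.1 := fun x => rfl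
  have hlt : ∀ x y, c x < c y ↔ x.1 < y.1 ∨ x.1 = y.1 ∧ x.2 < y.2 := by
    intro x y
    rw [Fin.lt_def, hc, hc, Fin.lt_def, Fin.lt_def, Fin.ext_iff]
    have hx := x.2.2
    have hy := y.2.2
    rcases lt_trichotomy (x.1 : ℕ) y.1 with h | h | h
    · have := Nat.mul_le_mul_left (N + 1) (Nat.succ_le_of_lt h)
      rw [Nat.mul_succ] at this
      omega
    · rw [h]
      omega
    · have := Nat.mul_le_mul_left (N + 1) (Nat.succ_le_of_lt h)
      rw [Nat.mul_succ] at this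
      omega
  have hother : ∀ q, q ∉ Set.range c → (M + 1) * (N + 1) ≤ (q : ℕ) := by
    intro q hq
    by_contra h
    apply hq
    refine ⟨finProdFinEquiv.symm ⟨q, by omega⟩, ?_⟩
    ext
    simp [c, Nat.mod_add_div]
  refine ⟨_, g, c, hlt, ?_, ?_, hα, hβ, hαβ, hcover, ?_⟩
  · intro q hq x
    have := (finProdFinEquiv x).2
    have h1 := hother q hq
    rw [Fin.lt_def]
    change ((finProdFinEquiv x : Fin _) : ℕ) < q
    omega
  · intro x
    simp only [hgc]
    rfl
  · intro q hq
    obtain ⟨u, v, huv, he⟩ := (mem_minimalMonomialGenerators_edgeIdeal_iff K G _).1 (g q).2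
    have hne : ∀ i j, (g q : V →₀ ℕ) ≠ Finsupp.single (α i) 1 + Finsupp.single (β j) 1 := by
      intro i j h
      apply hq
      refine ⟨(i, j), g.injective ?_⟩
      rw [hgc]
      exact Subtype.ext h.symm
    -- Any cross edge other than the last that is covered by the last one together with `q` is a
    -- witness.
    have key : ∀ i j, (i, j) ≠ (Fin.last M, Fin.last N) →
        ((g (c (Fin.last M, Fin.last N)) : V →₀ ℕ) ⊔ (g q : V →₀ ℕ)) (α i) ≠ 0 →
        ((g (c (Fin.last M, Fin.last N)) : V →₀ ℕ) ⊔ (g q : V →₀ ℕ)) (β j) ≠ 0 →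
        ∃ x, c x < c (Fin.last M, Fin.last N) ∧ (g (c x) : V →₀ ℕ) ≤
          (g (c (Fin.last M, Fin.last N)) : V →₀ ℕ) ⊔ (g q : V →₀ ℕ) := by
      intro i j hij h1 h2
      refine ⟨(i, j), (hlt _ _).2 ?_, ?_⟩
      · have h3 := Fin.le_last i
        have h4 := Fin.le_last j
        rcases h3.lt_or_eq with h | h
        · exact Or.inl h
        · rcases h4.lt_or_eq with h' | h'
          · exact Or.inr ⟨h, h'⟩
          · exact absurd (Prod.ext h h') hij
      · intro w
        rw [hgc]
        change (Finsupp.single (α i) 1 + Finsupp.single (β j) 1 : V →₀ ℕ) w ≤ _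
        rw [Finsupp.add_apply, Finsupp.single_apply, Finsupp.single_apply]
        by_cases e1 : α i = w
        · have e2 : β j ≠ w := fun e => hαβ i j (e1.trans e.symm)
          rw [if_pos e1, if_neg e2, ← e1]
          exact Nat.one_le_iff_ne_zero.2 h1
        · rw [if_neg e1]
          by_cases e2 : β j = w
          · rw [if_pos e2, ← e2, zero_add]
            exact Nat.one_le_iff_ne_zero.2 h2
          · rw [if_neg e2]
            exact Nat.zero_le _
    have hl : ∀ f : V →₀ ℕ,
        ((g (c (Fin.last M, Fin.last N)) : V →₀ ℕ) ⊔ f) (α (Fin.last M)) ≠ 0 := by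
      intro f
      rw [hgc, Finsupp.sup_apply]
      change max ((Finsupp.single (α _) 1 + Finsupp.single (β _) 1 : V →₀ ℕ) _) _ ≠ 0
      simp
    have hr : ∀ f : V →₀ ℕ,
        ((g (c (Fin.last M, Fin.last N)) : V →₀ ℕ) ⊔ f) (β (Fin.last N)) ≠ 0 := by
      intro f
      rw [hgc, Finsupp.sup_apply]
      change max ((Finsupp.single (α _) 1 + Finsupp.single (β _) 1 : V →₀ ℕ) _) _ ≠ 0
      simp
    have hu : ∀ f : V →₀ ℕ, (f ⊔ (g q : V →₀ ℕ)) u ≠ 0 := by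
      intro f
      rw [he, Finsupp.sup_apply]
      simp
    have hv : ∀ f : V →₀ ℕ, (f ⊔ (g q : V →₀ ℕ)) v ≠ 0 := by
      intro f
      rw [he, Finsupp.sup_apply]
      simp
    -- Since `q` is not a cross edge, both its ends lie on one side. They are distinct, so one of
    -- them is not the last vertex of that side; it is paired with the last vertex of the other
    -- side.
    rcases hcover u with ⟨i, rfl⟩ | ⟨j, rfl⟩ <;> rcases hcover v with ⟨i', rfl⟩ | ⟨j', rfl⟩
    · by_cases h : i = Fin.last M
      · refine key i' (Fin.last N) ?_ (hv _) (hr _)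
        intro e
        have e' : i' = Fin.last M := congrArg Prod.fst e
        exact huv.ne (by rw [h, ← e'])
      · exact key i (Fin.last N) (fun e => h (congrArg Prod.fst e)) (hu _) (hr _)
    · exact absurd he (hne i j')
    · exact absurd (he.trans (add_comm _ _)) (hne i' j)
    · by_cases h : j = Fin.last N
      · refine key (Fin.last M) j' ?_ (hl _) (hv _)
        intro e
        have e' : j' = Fin.last N := congrArg Prod.snd e
        exact huv.ne (by rw [h, ← e'])
      · exact key (Fin.last M) j (fun e => h (congrArg Prod.snd e)) (hl _) (hu _)

end EdgeIdeal

/-! ### The squarefree part of the Koszul complex -/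

section Koszul

open scoped Classical in
theorem zeroOneVector_apply {V : Type*} (F : Finset V) (v : V) :
    zeroOneVector F v = if v ∈ F then 1 else 0 := by
  simp [zeroOneVector, Finsupp.finsetSum_apply, Finsupp.single_apply]

variable {V K : Type*} [Fintype V] [DecidableEq V] [Field K]

/-- A system of signs for the Koszul complex on `V`. -/
structure IsKoszulSign (sgn : Finset V → V → K) : Prop where
  mul_self : ∀ F v, sgn F v * sgn F v = 1
  anticomm : ∀ F u v, u ∉ F → v ∉ F → u ≠ v →
    sgn F v * sgn (insert v F) u = - (sgn F u * sgn (insert u F) v)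

omit [Fintype V] in
theorem exists_isKoszulSign [Finite V] : ∃ sgn : Finset V → V → K, IsKoszulSign sgn := by
  obtain ⟨n, ⟨e⟩⟩ := Finite.exists_equiv_fin V
  refine ⟨fun F v => (-1) ^ (F.filter fun u => e u < e v).card, ?_, ?_⟩
  · intro F v
    rw [← mul_pow]
    simp
  · have key : ∀ (F : Finset V) (u v : V), u ∉ F → v ∉ F → e u < e v →
        (-1 : K) ^ (F.filter fun x => e x < e v).card *
          (-1) ^ ((insert v F).filter fun x => e x < e u).card =
        - ((-1) ^ (F.filter fun x => e x < e u).card *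
          (-1) ^ ((insert u F).filter fun x => e x < e v).card) := by
      intro F u v hu hv h
      rw [Finset.filter_insert, Finset.filter_insert, if_neg h.not_gt, if_pos h,
        Finset.card_insert_of_notMem (fun h' => hu (Finset.mem_filter.1 h').1), pow_succ]
      ring
    intro F u v hu hv huv
    rcases lt_or_gt_of_ne (e.injective.ne huv) with h | h
    · exact key F u v hu hv h
    · rw [key F v u hv hu h, neg_neg]

variable {X Y : Type*} [AddCommGroup X] [Module K X] [AddCommGroup Y] [Module K Y]

/-- The boundary map of the Koszul complex on `V`, all structure maps being identities. -/
def koszulBoundary (sgn : Finset V → V → K) (c : Finset V → X) (F : Finset V) : X :=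
  ∑ v ∈ Fᶜ, sgn F v • c (insert v F)

variable {sgn : Finset V → V → K}

theorem koszulBoundary_sub (c c' : Finset V → X) :
    koszulBoundary sgn (fun F => c F - c' F) =
      fun F => koszulBoundary sgn c F - koszulBoundary sgn c' F := by
  funext F
  simp only [koszulBoundary, smul_sub, Finset.sum_sub_distrib]

theorem koszulBoundary_map (f : X →ₗ[K] Y) (c : Finset V → X) (F : Finset V) :
    koszulBoundary sgn (fun F => f (c F)) F = f (koszulBoundary sgn c F) := by
  simp only [koszulBoundary, map_sum, map_smul]

theorem koszulBoundary_eq_zero_of_card {c : Finset V → X} {k : ℕ}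
    (hc : ∀ F, c F ≠ 0 → F.card = k) (F : Finset V) (h : koszulBoundary sgn c F ≠ 0) :
    F.card + 1 = k := by
  obtain ⟨v, hv, hne⟩ := Finset.exists_ne_zero_of_sum_ne_zero h
  rw [← hc (insert v F) (fun h0 => hne (by rw [h0, smul_zero])),
    Finset.card_insert_of_notMem (Finset.mem_compl.1 hv)]

theorem IsKoszulSign.koszulBoundary_koszulBoundary (hs : IsKoszulSign sgn) (c : Finset V → X)
    (F : Finset V) : koszulBoundary sgn (koszulBoundary sgn c) F = 0 := by
  simp only [koszulBoundary, Finset.smul_sum, smul_smul]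
  rw [Finset.sum_sigma']
  refine Finset.sum_involution (fun x _ => ⟨x.2, x.1⟩) ?_ ?_ ?_ ?_
  · rintro ⟨v, u⟩ h
    simp only [Finset.mem_sigma, Finset.mem_compl, Finset.mem_insert, not_or] at h
    simp only
    rw [Finset.insert_comm v u, ← add_smul, hs.anticomm F u v h.2.2 h.1 h.2.1, neg_add_cancel,
      zero_smul]
  · rintro ⟨v, u⟩ h - e
    simp only [Finset.mem_sigma, Finset.mem_compl, Finset.mem_insert, not_or] at h
    exact h.2.1 (congrArg Sigma.fst e)
  · rintro ⟨v, u⟩ h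
    simp only [Finset.mem_sigma, Finset.mem_compl, Finset.mem_insert, not_or] at h ⊢
    exact ⟨h.2.2, fun e => h.2.1 e.symm, h.1⟩
  · rintro ⟨v, u⟩ h
    rfl

/-- The contracting homotopy of the Koszul complex given by a vertex. -/
def koszulHomotopy (sgn : Finset V → V → K) (v₀ : V) (γ : Finset V → K) (F : Finset V) : K :=
  if v₀ ∈ F then sgn (F.erase v₀) v₀ * γ (F.erase v₀) else 0

/-- If `v₀ ∉ F`, only the summand inserting `v₀` survives. If `v₀ ∈ F`, the cycle condition at
`F.erase v₀` expresses `γ F` through the remaining values. -/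
theorem IsKoszulSign.koszulBoundary_koszulHomotopy (hs : IsKoszulSign sgn) (v₀ : V)
    {γ : Finset V → K} (hγ : ∀ F, koszulBoundary sgn γ F = 0) (F : Finset V) :
    koszulBoundary sgn (koszulHomotopy sgn v₀ γ) F = γ F := by
  by_cases hF : v₀ ∈ F
  · have hE : v₀ ∉ F.erase v₀ := Finset.notMem_erase _ _
    have hins : insert v₀ (F.erase v₀) = F := Finset.insert_erase hF
    have h1 := hγ (F.erase v₀)
    have hc : (F.erase v₀)ᶜ = insert v₀ Fᶜ := by
      ext x
      simp only [Finset.mem_compl, Finset.mem_erase, Finset.mem_insert]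
      tauto
    rw [koszulBoundary, hc, Finset.sum_insert (by simpa using hF), hins, smul_eq_mul] at h1
    have h2 : γ F = - ∑ v ∈ Fᶜ, sgn (F.erase v₀) v₀ *
        (sgn (F.erase v₀) v • γ (insert v (F.erase v₀))) := by
      rw [← Finset.mul_sum]
      have h3 := hs.mul_self (F.erase v₀) v₀
      linear_combination (sgn (F.erase v₀) v₀) * h1 - γ F * h3
    rw [h2, koszulBoundary, ← Finset.sum_neg_distrib]
    refine Finset.sum_congr rfl fun v hv => ?_
    have hvF := Finset.mem_compl.1 hv
    have hne : v₀ ≠ v := fun e => hvF (e ▸ hF)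
    have hvE : v ∉ F.erase v₀ := fun h => hvF (Finset.mem_of_mem_erase h)
    rw [koszulHomotopy, if_pos (Finset.mem_insert_of_mem hF), Finset.erase_insert_of_ne hne.symm]
    have h3 := hs.anticomm _ v₀ v hE hvE hne
    rw [hins] at h3
    have h4 := hs.mul_self (F.erase v₀) v₀
    have h5 := hs.mul_self F v
    have h6 := hs.mul_self (F.erase v₀) v
    have h7 := hs.mul_self (insert v (F.erase v₀)) v₀
    simp only [smul_eq_mul]
    have h8 : sgn F v * sgn (insert v (F.erase v₀)) v₀ =
        - (sgn (F.erase v₀) v₀ * sgn (F.erase v₀) v) := by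
      linear_combination (sgn F v * sgn (F.erase v₀) v) * h3 -
        sgn F v * sgn (insert v (F.erase v₀)) v₀ * h6 - sgn (F.erase v₀) v * sgn (F.erase v₀) v₀ * h5
    linear_combination γ (insert v (F.erase v₀)) * h8
  · rw [koszulBoundary, Finset.sum_eq_single v₀]
    · rw [koszulHomotopy, if_pos (Finset.mem_insert_self _ _), Finset.erase_insert hF, smul_eq_mul,
        ← mul_assoc, hs.mul_self, one_mul]
    · intro v _ hne
      rw [koszulHomotopy, if_neg, smul_zero]
      rw [Finset.mem_insert, not_or]
      exact ⟨hne.symm, hF⟩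
    · intro h
      exact absurd (Finset.mem_compl.2 hF) h

theorem le_zeroOneVector_compl_iff (a : V →₀ ℕ) (F : Finset V) :
    a ≤ zeroOneVector Fᶜ ↔ ∀ v, a v ≤ 1 ∧ (v ∈ F → a v = 0) := by
  refine forall_congr' fun v => ?_
  rw [zeroOneVector_apply]
  by_cases h : v ∈ F <;> simp [h]
  omega

/-- The part of degree `σ` of the free module with generators of degrees `deg`, all variables
being set to `1`. -/
def degreePart (K : Type*) [Field K] {V ι : Type*} (deg : ι → V →₀ ℕ) (σ : V →₀ ℕ) :
    Submodule K (ι → K) where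
  carrier := {x | ∀ b, x b ≠ 0 → deg b ≤ σ}
  add_mem' := by
    intro x y hx hy b h
    by_cases hb : x b = 0
    · exact hy b fun h' => h (by rw [Pi.add_apply, hb, h', add_zero])
    · exact hx b hb
  zero_mem' := fun b h => absurd rfl h
  smul_mem' := fun c x hx b h => hx b fun h' => h (by rw [Pi.smul_apply, h', smul_zero])

omit [Fintype V] [DecidableEq V] in
theorem degreePart_mono {ι : Type*} (deg : ι → V →₀ ℕ) {σ τ : V →₀ ℕ} (h : σ ≤ τ) :
    degreePart K deg σ ≤ degreePart K deg τ := fun _ hx b hb => (hx b hb).trans h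

theorem zeroOneVector_compl_insert_le (v : V) (F : Finset V) :
    zeroOneVector (insert v F)ᶜ ≤ zeroOneVector Fᶜ := by
  intro w
  rw [zeroOneVector_apply, zeroOneVector_apply]
  by_cases h : w ∈ F <;> simp [h]
  split_ifs <;> simp

theorem koszulBoundary_mem_degreePart {ι : Type*} {deg : ι → V →₀ ℕ} {c : Finset V → ι → K}
    (hc : ∀ F, c F ∈ degreePart K deg (zeroOneVector Fᶜ)) (F : Finset V) :
    koszulBoundary sgn c F ∈ degreePart K deg (zeroOneVector Fᶜ) :=
  Submodule.sum_mem _ fun v _ => Submodule.smul_mem _ _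
    (degreePart_mono _ (zeroOneVector_compl_insert_le v F) (hc _))

/-- The Koszul complex of a graded free module in multidegree `V` splits over the generators. A
generator whose degree vanishes at some vertex contributes an acyclic complex; a generator of degree
`V` contributes only in Koszul degree `0`, which `hi` excludes. -/
theorem IsKoszulSign.exists_koszulBoundary_eq (hs : IsKoszulSign sgn) {ι : Type*}
    {deg : ι → V →₀ ℕ} {i : ℕ} (hi : 0 < i ∨ ∀ b, deg b ≠ zeroOneVector Finset.univ)
    {c : Finset V → ι → K} (hc : ∀ F, c F ∈ degreePart K deg (zeroOneVector Fᶜ))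
    (hci : ∀ F, c F ≠ 0 → F.card = i) (hcycle : ∀ F, koszulBoundary sgn c F = 0) :
    ∃ w : Finset V → ι → K, (∀ F, w F ∈ degreePart K deg (zeroOneVector Fᶜ)) ∧
      (∀ F, w F ≠ 0 → F.card = i + 1) ∧ ∀ F, koszulBoundary sgn w F = c F := by
  classical
  have hcoord : ∀ (x : Finset V → ι → K) b F,
      koszulBoundary sgn x F b = koszulBoundary sgn (fun F => x F b) F := fun x b F =>
    (koszulBoundary_map (LinearMap.proj (R := K) (φ := fun _ : ι => K) b) x F).symm
  -- The contracting vertex depends on the coordinate `b`. As `deg b` vanishes there, adding that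
  -- vertex to `F` keeps the chain inside `degreePart`.
  set w : Finset V → ι → K := fun F b =>
    if h : ∃ v, deg b v = 0 then koszulHomotopy sgn h.choose (fun F => c F b) F else 0 with hw
  have hwF : ∀ F b, w F b ≠ 0 → ∃ v, deg b v = 0 ∧ v ∈ F ∧ c (F.erase v) b ≠ 0 := by
    intro F b h
    simp only [hw] at h
    split_ifs at h with h1
    · rw [koszulHomotopy] at h
      split_ifs at h with h2
      · exact ⟨h1.choose, h1.choose_spec, h2, right_ne_zero_of_mul h⟩
      · exact absurd rfl h
    · exact absurd rfl h
  refine ⟨w, ?_, ?_, ?_⟩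
  · intro F b h
    obtain ⟨v, hv0, hvF, hne⟩ := hwF F b h
    have h1 := (le_zeroOneVector_compl_iff _ _).1 (hc _ b hne)
    rw [le_zeroOneVector_compl_iff]
    intro u
    refine ⟨(h1 u).1, fun hu => ?_⟩
    by_cases huv : u = v
    · rw [huv, hv0]
    · exact (h1 u).2 (Finset.mem_erase.2 ⟨huv, hu⟩)
  · intro F h
    obtain ⟨b, hb⟩ := Function.ne_iff.1 h
    obtain ⟨v, hv0, hvF, hne⟩ := hwF F b hb
    rw [← hci (F.erase v) (fun h => hne (by rw [h]; rfl)), Finset.card_erase_add_one hvF]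
  · intro F
    funext b
    rw [hcoord]
    by_cases h : ∃ v, deg b v = 0
    · have h1 : (fun F => w F b) = koszulHomotopy sgn h.choose (fun F => c F b) := by
        funext F
        simp only [hw, dif_pos h]
      rw [h1]
      refine hs.koszulBoundary_koszulHomotopy _ (fun F => ?_) F
      rw [← hcoord, hcycle]
      rfl
    · have h1 : (fun F => w F b) = fun _ => 0 := by
        funext F
        simp only [hw, dif_neg h]
      rw [h1]
      simp only [koszulBoundary, smul_zero, Finset.sum_const_zero]
      by_contra hne
      have h2 := (le_zeroOneVector_compl_iff _ _).1 (hc F b (Ne.symm hne))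
      push Not at h
      -- A generator of full support is present in degree `Fᶜ` only for `F = ∅`, and then its degree
      -- is exactly `V`.
      have hF : F = ∅ := Finset.eq_empty_of_forall_notMem fun v hv => h v ((h2 v).2 hv)
      have hi0 : 0 = i := by
        rw [← hci F (fun h => hne (by rw [h]; rfl)), hF, Finset.card_empty]
      rcases hi with hi | hi
      · omega
      · apply hi b
        ext v
        rw [zeroOneVector_apply, if_pos (Finset.mem_univ v)]
        have := (h2 v).1
        have := h v
        omega

/-- Zigzag between the Koszul complex and a graded resolution (with all variables set to `1`) of a
monomial quotient ring. The predicate `A` tells which monomials lie in the ideal; the ideal contains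
the products of a vertex in `P` and a vertex outside `P`, but neither `1` nor any variable. -/
theorem exists_degree_eq_univ_of_exact {r : ℕ → ℕ} {deg : ∀ i, Fin (r i) → V →₀ ℕ}
    (D : ∀ i, (Fin (r (i + 1)) → K) →ₗ[K] (Fin (r i) → K)) (ε : (Fin (r 0) → K) →ₗ[K] K)
    (A : (V →₀ ℕ) → Prop)
    (hD : ∀ i σ, ∀ x ∈ degreePart K (deg (i + 1)) σ, D i x ∈ degreePart K (deg i) σ)
    (hDD : ∀ i x, D i (D (i + 1) x) = 0)
    (hexact : ∀ i σ, ∀ x ∈ degreePart K (deg (i + 1)) σ, D i x = 0 →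
      ∃ y ∈ degreePart K (deg (i + 2)) σ, D (i + 1) y = x)
    (hε : ∃ e ∈ degreePart K (deg 0) 0, ε e = 1)
    (hexact₀ : ∀ σ, ∀ x ∈ degreePart K (deg 0) σ, (A σ ∨ ε x = 0) →
      ∃ y ∈ degreePart K (deg 1) σ, D 0 y = x)
    (hεD : ∀ σ, ¬ A σ → ∀ x ∈ degreePart K (deg 1) σ, ε (D 0 x) = 0)
    (P : V → Prop) (hPA : ∀ F u v, u ∉ F → v ∉ F → P u → ¬ P v → A (zeroOneVector Fᶜ))
    (hA : ∀ v, ¬ A (zeroOneVector (Finset.univ.erase v)ᶜ)) (hP : ∃ v, P v) (hP' : ∃ v, ¬ P v)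
    {s : ℕ} (hs : s + 1 = Fintype.card V) :
    ∃ b, deg s b = zeroOneVector Finset.univ := by
  classical
  by_contra hdeg
  push Not at hdeg
  obtain ⟨sgn, hsgn⟩ := exists_isKoszulSign (V := V) (K := K)
  have hs0 : 0 < s := by
    obtain ⟨u, hu⟩ := hP
    obtain ⟨v, hv⟩ := hP'
    have : 1 < Fintype.card V := Fintype.one_lt_card_iff.2 ⟨u, v, fun e => hv (e ▸ hu)⟩
    omega
  -- Iterated connecting maps: `c` is a Koszul cycle with values in the image of `D j`, of Koszul
  -- degree `s - j - 1`, that bounds no chain with values in that image.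
  have main : ∀ j, j ≤ s → ∃ c : Finset V → Fin (r j) → K,
      (∀ F, ∃ y ∈ degreePart K (deg (j + 1)) (zeroOneVector Fᶜ), D j y = c F) ∧
      (∀ F, c F ≠ 0 → F.card + j + 1 = s) ∧ (∀ F, koszulBoundary sgn c F = 0) ∧
      ∀ w : Finset V → Fin (r j) → K,
        (∀ F, ∃ y ∈ degreePart K (deg (j + 1)) (zeroOneVector Fᶜ), D j y = w F) →
        (∀ F, w F ≠ 0 → F.card + j = s) → ¬ ∀ F, koszulBoundary sgn w F = c F := by
    intro j
    induction j with
    | zero =>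
      intro _
      obtain ⟨e, he, hεe⟩ := hε
      -- `η` is the top Koszul chain, and `ζ` is the part of its boundary at those `univ.erase u`
      -- with `P u`: the indicator of `P` up to signs. The chain `z` lifts `ζ` to the free module in
      -- degree `0`.
      set η : Finset V → K := fun F => if F = Finset.univ then 1 else 0 with hη
      set ζ : Finset V → K := fun F =>
        ∑ u ∈ Fᶜ, if P u then sgn F u * η (insert u F) else 0 with hζ
      set z : Finset V → Fin (r 0) → K := fun F => ζ F • e with hz
      have hzmem : ∀ F, z F ∈ degreePart K (deg 0) (zeroOneVector Fᶜ) := fun F =>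
        Submodule.smul_mem _ _ (degreePart_mono _ zero_le he)
      have hzs : ∀ F, z F ≠ 0 → F.card = s := by
        intro F h
        obtain ⟨u, hu, hne⟩ := Finset.exists_ne_zero_of_sum_ne_zero (left_ne_zero_of_smul h)
        have h1 : insert u F = Finset.univ := by
          by_contra h1
          simp [hη, h1] at hne
        have h2 := congrArg Finset.card h1
        rw [Finset.card_insert_of_notMem (Finset.mem_compl.1 hu), Finset.card_univ] at h2
        omega
      have hεz : ∀ F, ε (z F) = ζ F := fun F => by
        rw [hz]
        simp only [map_smul, hεe, smul_eq_mul, mul_one]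
      refine ⟨koszulBoundary sgn z, ?_, ?_, hsgn.koszulBoundary_koszulBoundary z, ?_⟩
      · intro F
        refine hexact₀ _ _ (koszulBoundary_mem_degreePart hzmem F) ?_
        -- If `Fᶜ` meets both sides, the monomial lies in the ideal. If it lies within `P`, then `ζ`
        -- agrees with the boundary of `η` on the sets involved; if it misses `P`, then `ζ` vanishes
        -- on them.
        by_cases h1 : ∃ u, u ∉ F ∧ P u
        · obtain ⟨u, hu, hPu⟩ := h1
          by_cases h2 : ∃ v, v ∉ F ∧ ¬ P v
          · obtain ⟨v, hv, hPv⟩ := h2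
            exact Or.inl (hPA F u v hu hv hPu hPv)
          · right
            push Not at h2
            rw [← koszulBoundary_map, ← hsgn.koszulBoundary_koszulBoundary η F]
            refine Finset.sum_congr rfl fun v hv => ?_
            simp only [hεz]
            congr 1
            refine Finset.sum_congr rfl fun u hu => ?_
            rw [if_pos (h2 u fun h => Finset.mem_compl.1 hu (Finset.mem_insert_of_mem h)),
              smul_eq_mul]
        · right
          push Not at h1
          rw [← koszulBoundary_map]
          refine Finset.sum_eq_zero fun v hv => ?_
          simp only [hεz, hζ]
          rw [Finset.sum_eq_zero, smul_zero]
          intro u hu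
          rw [if_neg (h1 u fun h => Finset.mem_compl.1 hu (Finset.mem_insert_of_mem h))]
      · intro F h
        have := koszulBoundary_eq_zero_of_card hzs F h
        omega
      · intro w hw hws hwz
        obtain ⟨u, hu, hus, huz⟩ := hsgn.exists_koszulBoundary_eq (deg := deg 0) (Or.inl hs0)
          (c := fun F => z F - w F)
          (fun F => by
            obtain ⟨y, hy, hyw⟩ := hw F
            exact Submodule.sub_mem _ (hzmem F) (hyw ▸ hD 0 _ y hy))
          (fun F h => by
            by_cases h1 : z F = 0
            · by_contra h2
              apply h
              have : w F = 0 := by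
                by_contra h3
                have := hws F h3
                omega
              simp only [h1, this, sub_zero]
            · exact hzs F h1)
          (fun F => by rw [koszulBoundary_sub]; simp only [hwz, sub_self])
        -- If `∂z` bounded in the image, `ζ` would be the boundary of a multiple of `η`, making the
        -- indicator of `P` constant.
        have key : ∀ v, ε (u Finset.univ) = if P v then 1 else 0 := by
          intro v
          have h1 := congrArg ε (huz (Finset.univ.erase v))
          have hcompl : (Finset.univ.erase v)ᶜ = {v} := by
            ext x
            simp
          have hins : insert v (Finset.univ.erase v) = Finset.univ := by simp
          obtain ⟨y, hy, hyw⟩ := hw (Finset.univ.erase v)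
          have h2 : ε (w (Finset.univ.erase v)) = 0 := by
            rw [← hyw]
            exact hεD _ (hA v) y hy
          rw [koszulBoundary, map_sub, h2, hεz, hcompl, Finset.sum_singleton, hins, map_smul,
            sub_zero, hζ] at h1
          simp only [hcompl, Finset.sum_singleton, hins, hη, if_true, mul_one, smul_eq_mul] at h1
          have h3 := hsgn.mul_self (Finset.univ.erase v) v
          by_cases hv : P v
          · rw [if_pos hv] at h1 ⊢
            linear_combination (sgn (Finset.univ.erase v) v) * h1 +
              (1 - ε (u Finset.univ)) * h3
          · rw [if_neg hv] at h1 ⊢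
            linear_combination (sgn (Finset.univ.erase v) v) * h1 - ε (u Finset.univ) * h3
        obtain ⟨v, hv⟩ := hP
        obtain ⟨v', hv'⟩ := hP'
        have h1 := key v
        rw [key v', if_pos hv, if_neg hv'] at h1
        exact zero_ne_one h1
    | succ j ih =>
      intro hj
      obtain ⟨c, hcB, hcs, hcycle, hcn⟩ := ih (by omega)
      have hlift : ∀ F, ∃ y ∈ degreePart K (deg (j + 1)) (zeroOneVector Fᶜ),
          D j y = c F ∧ (c F = 0 → y = 0) := by
        intro F
        by_cases h : c F = 0
        · exact ⟨0, Submodule.zero_mem _, by rw [h, map_zero], fun _ => rfl⟩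
        · obtain ⟨y, hy, hyc⟩ := hcB F
          exact ⟨y, hy, hyc, fun h' => absurd h' h⟩
      choose c' hc'mem hc' hc'0 using hlift
      have hc's : ∀ F, c' F ≠ 0 → F.card = s - j - 1 := by
        intro F h
        have := hcs F (fun h' => h (hc'0 F h'))
        omega
      refine ⟨koszulBoundary sgn c', ?_, ?_, hsgn.koszulBoundary_koszulBoundary c', ?_⟩
      · intro F
        refine hexact j _ _ (koszulBoundary_mem_degreePart hc'mem F) ?_
        rw [← koszulBoundary_map]
        simp only [hc']
        exact hcycle F
      · intro F h
        have := koszulBoundary_eq_zero_of_card hc's F h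
        omega
      · intro w hw hws hwc
        -- The assumed absence of a generator of degree `V` is needed only when `j + 1 = s`, where
        -- the Koszul degree reaches `0`.
        have hi : 0 < s - j - 1 ∨ ∀ b, deg (j + 1) b ≠ zeroOneVector Finset.univ := by
          rcases Nat.lt_or_ge (j + 1) s with h | h
          · left
            omega
          · right
            have : s = j + 1 := by omega
            subst this
            exact hdeg
        obtain ⟨u, hu, hus, huz⟩ := hsgn.exists_koszulBoundary_eq hi
          (c := fun F => c' F - w F)
          (fun F => by
            obtain ⟨y, hy, hyw⟩ := hw F
            exact Submodule.sub_mem _ (hc'mem F) (hyw ▸ hD (j + 1) _ y hy))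
          (fun F h => by
            by_cases h1 : c' F = 0
            · by_contra h2
              apply h
              have : w F = 0 := by
                by_contra h3
                have := hws F h3
                omega
              simp only [h1, this, sub_zero]
            · exact hc's F h1)
          (fun F => by rw [koszulBoundary_sub]; simp only [hwc, sub_self])
        -- Applying `D j` to `∂u = c' - w` kills `w` and exhibits `c` as a boundary from the image
        -- of `D j`.
        refine hcn (fun F => D j (u F)) (fun F => ⟨u F, hu F, rfl⟩) (fun F h => ?_) (fun F => ?_)
        · have := hus F (fun h' => h (by rw [h', map_zero]))
          omega
        · obtain ⟨y, hy, hyw⟩ := hw F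
          rw [koszulBoundary_map, huz, map_sub, hc', ← hyw, hDD, sub_zero]
  -- At `j = s` no cardinality is allowed, so `c = 0`, which is the boundary of the zero chain.
  obtain ⟨c, -, hcs, -, hcn⟩ := main s le_rfl
  refine hcn (fun _ => 0) (fun F => ⟨0, Submodule.zero_mem _, map_zero _⟩)
    (fun F h => absurd rfl h) fun F => ?_
  have h0 : c F = 0 := by
    by_contra h
    have := hcs F h
    omega
  rw [h0]
  simp only [koszulBoundary, smul_zero, Finset.sum_const_zero]

end Koszul

/-! ### Graded free modules over the polynomial ring -/

section GradedFree

variable {V K : Type*} [Field K] {ι κ : Type*}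

/-- All homogeneous components of `f` in the free module with generators of degrees `deg` have
their degrees in `Q`. -/
def DegreesIn (deg : ι → V →₀ ℕ) (Q : Set (V →₀ ℕ)) (f : ι → MvPolynomial V K) : Prop :=
  ∀ b, ∀ u ∈ (f b).support, deg b + u ∈ Q

theorem DegreesIn.add {deg : ι → V →₀ ℕ} {Q : Set (V →₀ ℕ)} {f f' : ι → MvPolynomial V K}
    (hf : DegreesIn deg Q f) (hf' : DegreesIn deg Q f') : DegreesIn deg Q (f + f') := by
  classical
  intro b u hu
  rcases Finset.mem_union.1 (MvPolynomial.support_add hu) with h | h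
  · exact hf b u h
  · exact hf' b u h

theorem DegreesIn.zero (deg : ι → V →₀ ℕ) (Q : Set (V →₀ ℕ)) :
    DegreesIn deg Q (0 : ι → MvPolynomial V K) := by
  intro b u hu
  simp at hu

theorem DegreesIn.smul {deg : ι → V →₀ ℕ} {Q : Set (V →₀ ℕ)} {f : ι → MvPolynomial V K}
    {δ : V →₀ ℕ} (hf : DegreesIn deg {δ} f) {p : MvPolynomial V K}
    (hp : ∀ u ∈ p.support, δ + u ∈ Q) : DegreesIn deg Q (p • f) := by
  classical
  intro b u hu
  rw [Pi.smul_apply, smul_eq_mul] at hu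
  obtain ⟨w, hw, x, hx, rfl⟩ := Finset.mem_add.1 (MvPolynomial.support_mul _ _ hu)
  have h1 : deg b + x = δ := hf b x hx
  have h2 := hp w hw
  rwa [← h1, add_assoc, add_comm x w] at h2

/-- The homogeneous component of degree `δ`. -/
noncomputable def gradedComponent (deg : ι → V →₀ ℕ) (δ : V →₀ ℕ) (f : ι → MvPolynomial V K) :
    ι → MvPolynomial V K := by
  classical
  exact fun b => if deg b ≤ δ then
    MvPolynomial.monomial (δ - deg b) (MvPolynomial.coeff (δ - deg b) (f b)) else 0

open scoped Classical in
theorem coeff_gradedComponent (deg : ι → V →₀ ℕ) (δ : V →₀ ℕ) (f : ι → MvPolynomial V K) (b : ι)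
    (u : V →₀ ℕ) : MvPolynomial.coeff u (gradedComponent deg δ f b) =
      if deg b + u = δ then MvPolynomial.coeff u (f b) else 0 := by
  rw [gradedComponent]
  by_cases h : deg b + u = δ
  · subst h
    rw [if_pos rfl, if_pos le_self_add, add_tsub_cancel_left, MvPolynomial.coeff_monomial,
      if_pos rfl]
  · rw [if_neg h]
    split_ifs with h'
    · rw [MvPolynomial.coeff_monomial, if_neg]
      rintro rfl
      exact h (add_tsub_cancel_of_le h')
    · simp

theorem degreesIn_gradedComponent (deg : ι → V →₀ ℕ) (δ : V →₀ ℕ) (f : ι → MvPolynomial V K) :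
    DegreesIn deg {δ} (gradedComponent deg δ f) := by
  classical
  intro b u hu
  rw [MvPolynomial.mem_support_iff, coeff_gradedComponent] at hu
  by_contra h
  exact hu (if_neg h)

theorem degreesIn_sub_gradedComponent (deg : ι → V →₀ ℕ) (δ : V →₀ ℕ)
    (f : ι → MvPolynomial V K) : DegreesIn deg {δ}ᶜ (f - gradedComponent deg δ f) := by
  classical
  intro b u hu h
  rw [MvPolynomial.mem_support_iff, Pi.sub_apply, MvPolynomial.coeff_sub, coeff_gradedComponent,
    if_pos (Set.mem_singleton_iff.1 h), sub_self] at hu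
  exact hu rfl

theorem DegreesIn.gradedComponent_eq {deg : ι → V →₀ ℕ} {δ : V →₀ ℕ} {f : ι → MvPolynomial V K}
    (hf : DegreesIn deg {δ} f) : gradedComponent deg δ f = f := by
  classical
  funext b
  ext u
  rw [coeff_gradedComponent]
  split_ifs with h
  · rfl
  · by_contra hne
    exact h (hf b u (MvPolynomial.mem_support_iff.2 (Ne.symm hne)))

theorem DegreesIn.gradedComponent_eq_zero {deg : ι → V →₀ ℕ} {δ : V →₀ ℕ}
    {f : ι → MvPolynomial V K} (hf : DegreesIn deg {δ}ᶜ f) : gradedComponent deg δ f = 0 := by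
  classical
  funext b
  ext u
  rw [coeff_gradedComponent, Pi.zero_apply, MvPolynomial.coeff_zero]
  split_ifs with h
  · by_contra hne
    exact hf b u (MvPolynomial.mem_support_iff.2 hne) h
  · rfl

theorem gradedComponent_add (deg : ι → V →₀ ℕ) (δ : V →₀ ℕ) (f f' : ι → MvPolynomial V K) :
    gradedComponent deg δ (f + f') = gradedComponent deg δ f + gradedComponent deg δ f' := by
  classical
  funext b
  ext u
  simp only [coeff_gradedComponent, Pi.add_apply, MvPolynomial.coeff_add]
  split_ifs <;> simp

section Maps

variable [Fintype ι] [DecidableEq ι] {deg' : ι → V →₀ ℕ} {deg : κ → V →₀ ℕ}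
  {F : (ι → MvPolynomial V K) →ₗ[MvPolynomial V K] (κ → MvPolynomial V K)}

theorem DegreesIn.map (hF : ∀ b, DegreesIn deg {deg' b} (F (Pi.single b 1)))
    {Q : Set (V →₀ ℕ)} {f : ι → MvPolynomial V K} (hf : DegreesIn deg' Q f) :
    DegreesIn deg Q (F f) := by
  rw [LinearMap.pi_apply_eq_sum_univ]
  refine Finset.sum_induction _ (DegreesIn deg Q) (fun _ _ => DegreesIn.add)
    (DegreesIn.zero _ _) fun b _ => ?_
  have : (fun j => if b = j then (1 : MvPolynomial V K) else 0) = Pi.single b 1 := by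
    funext j
    rw [Pi.single_apply]
    simp only [eq_comm]
  rw [this]
  exact (hF b).smul (hf b)

/-- Split `f` into its component of degree `δ` and the rest; the homogeneous map keeps the two sets
of degrees apart. -/
theorem map_gradedComponent (hF : ∀ b, DegreesIn deg {deg' b} (F (Pi.single b 1))) (δ : V →₀ ℕ)
    (f : ι → MvPolynomial V K) :
    F (gradedComponent deg' δ f) = gradedComponent deg δ (F f) := by
  have h : F f = F (gradedComponent deg' δ f) + F (f - gradedComponent deg' δ f) := by
    rw [← map_add, add_sub_cancel]
  rw [h, gradedComponent_add, ((degreesIn_gradedComponent deg' δ f).map hF).gradedComponent_eq,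
    ((degreesIn_sub_gradedComponent deg' δ f).map hF).gradedComponent_eq_zero, add_zero]

end Maps

/-! ### Setting all variables to `1` -/

/-- Set all variables to `1`. -/
noncomputable def dehomogenize (f : ι → MvPolynomial V K) (b : ι) : K :=
  MvPolynomial.eval 1 (f b)

/-- The homogeneous element of degree `δ` with given coefficients. -/
noncomputable def homogenize (deg : ι → V →₀ ℕ) (δ : V →₀ ℕ) (x : ι → K) (b : ι) :
    MvPolynomial V K :=
  MvPolynomial.monomial (δ - deg b) (x b)

theorem eval_one_monomial (u : V →₀ ℕ) (c : K) :
    MvPolynomial.eval 1 (MvPolynomial.monomial u c) = c := by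
  simp [MvPolynomial.eval_monomial]

theorem dehomogenize_homogenize (deg : ι → V →₀ ℕ) (δ : V →₀ ℕ) (x : ι → K) :
    dehomogenize (homogenize deg δ x) = x :=
  funext fun _ => eval_one_monomial _ _

theorem degreesIn_homogenize {deg : ι → V →₀ ℕ} {δ : V →₀ ℕ} {x : ι → K}
    (hx : x ∈ degreePart K deg δ) : DegreesIn deg {δ} (homogenize deg δ x) := by
  classical
  intro b u hu
  rw [homogenize, MvPolynomial.mem_support_iff, MvPolynomial.coeff_monomial] at hu
  split_ifs at hu with h
  · rw [← h]
    exact add_tsub_cancel_of_le (hx b hu)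
  · exact absurd rfl hu

theorem DegreesIn.dehomogenize_mem {deg : ι → V →₀ ℕ} {δ : V →₀ ℕ} {f : ι → MvPolynomial V K}
    (hf : DegreesIn deg {δ} f) : dehomogenize f ∈ degreePart K deg δ := by
  intro b hb
  have h : f b ≠ 0 := by
    intro h
    apply hb
    rw [dehomogenize, h, map_zero]
  obtain ⟨u, hu⟩ := Finset.nonempty_iff_ne_empty.2 (mt MvPolynomial.support_eq_empty.1 h)
  exact (hf b u hu) ▸ le_self_add

/-- Each coordinate of a homogeneous element is a scalar times one fixed monomial, so evaluation at
`1` loses nothing. -/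
theorem DegreesIn.homogenize_dehomogenize {deg : ι → V →₀ ℕ} {δ : V →₀ ℕ}
    {f : ι → MvPolynomial V K} (hf : DegreesIn deg {δ} f) :
    homogenize deg δ (dehomogenize f) = f := by
  classical
  have h : ∀ b, ∃ c, f b = MvPolynomial.monomial (δ - deg b) c := by
    intro b
    have h1 := congrFun hf.gradedComponent_eq b
    rw [gradedComponent] at h1
    split_ifs at h1
    · exact ⟨_, h1.symm⟩
    · exact ⟨0, by rw [← h1, map_zero]⟩
  funext b
  obtain ⟨c, hc⟩ := h b
  rw [homogenize, dehomogenize, hc, eval_one_monomial]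

theorem DegreesIn.eq_zero_of_dehomogenize {deg : ι → V →₀ ℕ} {δ : V →₀ ℕ}
    {f : ι → MvPolynomial V K} (hf : DegreesIn deg {δ} f) (h : dehomogenize f = 0) : f = 0 := by
  rw [← hf.homogenize_dehomogenize, h]
  funext b
  rw [homogenize, Pi.zero_apply, Pi.zero_apply, map_zero]

variable [Fintype ι] [DecidableEq ι]

/-- The matrix of a map of free modules, all variables being set to `1`. -/
noncomputable def dehomogenizeMap
    (F : (ι → MvPolynomial V K) →ₗ[MvPolynomial V K] (κ → MvPolynomial V K)) :
    (ι → K) →ₗ[K] (κ → K) :=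
  Fintype.linearCombination K fun b => dehomogenize (F (Pi.single b 1))

theorem dehomogenize_map
    (F : (ι → MvPolynomial V K) →ₗ[MvPolynomial V K] (κ → MvPolynomial V K))
    (f : ι → MvPolynomial V K) : dehomogenize (F f) = dehomogenizeMap F (dehomogenize f) := by
  funext k
  rw [dehomogenizeMap, Fintype.linearCombination_apply, LinearMap.pi_apply_eq_sum_univ]
  simp only [dehomogenize, Finset.sum_apply, Pi.smul_apply, smul_eq_mul, map_sum, map_mul]
  refine Finset.sum_congr rfl fun b _ => ?_
  have : (fun j => if b = j then (1 : MvPolynomial V K) else 0) = Pi.single b 1 := by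
    funext j
    rw [Pi.single_apply]
    simp only [eq_comm]
  rw [this]

theorem dehomogenizeMap_mem {deg' : ι → V →₀ ℕ} {deg : κ → V →₀ ℕ}
    {F : (ι → MvPolynomial V K) →ₗ[MvPolynomial V K] (κ → MvPolynomial V K)}
    (hF : ∀ b, DegreesIn deg {deg' b} (F (Pi.single b 1))) {δ : V →₀ ℕ} {x : ι → K}
    (hx : x ∈ degreePart K deg' δ) : dehomogenizeMap F x ∈ degreePart K deg δ := by
  rw [← dehomogenize_homogenize deg' δ x, ← dehomogenize_map]
  exact ((degreesIn_homogenize hx).map hF).dehomogenize_mem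

end GradedFree

/-! ### From a graded resolution over `S` to the zigzag over `K` -/

section Resolution

variable {V K : Type*} [Field K]

/-- Exactness in each multidegree becomes exactness between the spaces `degreePart` once all
variables are set to `1`, which is the input of the zigzag. Minimality plays no role here. -/
theorem MultigradedFreeResolution.exists_deg_eq_univ [Fintype V] {I : Ideal (MvPolynomial V K)}
    (R : MultigradedFreeResolution I) (hI : ∀ p ∈ I, MvPolynomial.coeff 0 p = 0) (P : V → Prop)
    (hP : ∃ v, P v) (hP' : ∃ v, ¬ P v)
    (hPI : ∀ u v, P u → ¬ P v → MvPolynomial.X u * MvPolynomial.X v ∈ I)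
    (hX : ∀ v, MvPolynomial.X v ∉ I) {s : ℕ} (hs : s + 1 = Fintype.card V) :
    ∃ b, R.deg s b = zeroOneVector Finset.univ := by
  classical
  have hd : ∀ i b, DegreesIn (R.deg i) {R.deg (i + 1) b} (R.d i (Pi.single b 1)) :=
    fun i b b' u hu => R.d_homogeneous i b b' u hu
  choose a ha using R.aug_homogeneous
  -- A homogeneous lift of the augmentation from `S/I` to `S`, so that its variables can be set to
  -- `1` too.
  set φ : (Fin (R.rank 0) → MvPolynomial V K) →ₗ[MvPolynomial V K] (Unit → MvPolynomial V K) :=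
    Fintype.linearCombination (MvPolynomial V K)
      (fun b _ => MvPolynomial.monomial (R.deg 0 b) (a b)) with hφ
  have hφd : ∀ b, DegreesIn (fun _ : Unit => (0 : V →₀ ℕ)) {R.deg 0 b} (φ (Pi.single b 1)) := by
    intro b k u hu
    rw [hφ, Fintype.linearCombination_apply_single, one_smul, MvPolynomial.mem_support_iff,
      MvPolynomial.coeff_monomial] at hu
    split_ifs at hu with h
    · rw [zero_add, ← h]
      rfl
    · exact absurd rfl hu
  have haug : ∀ f, R.aug f = Ideal.Quotient.mk I (φ f ()) := by
    intro f
    have : R.aug = (I.mkQ.comp (LinearMap.proj ())).comp φ := by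
      refine LinearMap.pi_ext' fun b => LinearMap.ext_ring ?_
      change R.aug (Pi.single b 1) = Ideal.Quotient.mk I (φ (Pi.single b 1) ())
      rw [ha, hφ, Fintype.linearCombination_apply_single, one_smul]
    rw [this]
    rfl
  have haug0 : ∀ f, R.aug f = 0 ↔ φ f () ∈ I := fun f => by
    rw [haug, Ideal.Quotient.eq_zero_iff_mem]
  set ε : (Fin (R.rank 0) → K) →ₗ[K] K :=
    (LinearMap.proj ()).comp (dehomogenizeMap φ) with hε
  have hεφ : ∀ f, ε (dehomogenize f) = MvPolynomial.eval 1 (φ f ()) := by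
    intro f
    rw [hε, LinearMap.comp_apply, ← dehomogenize_map]
    rfl
  have hφσ : ∀ σ f, DegreesIn (R.deg 0) {σ} f →
      φ f () = MvPolynomial.monomial σ (ε (dehomogenize f)) := by
    intro σ f hf
    have h1 := congrFun (hf.map hφd).homogenize_dehomogenize ()
    rw [homogenize, tsub_zero] at h1
    rw [hεφ]
    exact h1.symm
  have lift : ∀ i σ (x : Fin (R.rank i) → K), x ∈ degreePart K (R.deg i) σ →
      homogenize (R.deg i) σ x ∈ LinearMap.range (R.d i) →
      ∃ y ∈ degreePart K (R.deg (i + 1)) σ, dehomogenizeMap (R.d i) y = x := by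
    rintro i σ x hx ⟨y, hy⟩
    refine ⟨dehomogenize (gradedComponent (R.deg (i + 1)) σ y),
      (degreesIn_gradedComponent _ _ _).dehomogenize_mem, ?_⟩
    rw [← dehomogenize_map, map_gradedComponent (hd i), hy,
      (degreesIn_homogenize hx).gradedComponent_eq, dehomogenize_homogenize]
  refine exists_degree_eq_univ_of_exact (fun i => dehomogenizeMap (R.d i)) ε
    (fun σ => MvPolynomial.monomial σ (1 : K) ∈ I) (fun i σ x hx => dehomogenizeMap_mem (hd i) hx)
    ?_ ?_ ?_ ?_ ?_ P ?_ ?_ hP hP' hs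
  · intro i x
    -- Any vector over `K` lifts to constants; no grading is needed for `D ∘ D = 0`.
    rw [← dehomogenize_homogenize 0 0 x, ← dehomogenize_map, ← dehomogenize_map]
    have : R.d (i + 1) (homogenize 0 0 x) ∈ LinearMap.ker (R.d i) :=
      R.exact_succ i ▸ LinearMap.mem_range_self _ _
    rw [LinearMap.mem_ker.1 this]
    funext b
    exact map_zero _
  · intro i σ x hx h0
    refine lift (i + 1) σ x hx ?_
    rw [R.exact_succ, LinearMap.mem_ker]
    refine ((degreesIn_homogenize hx).map (hd i)).eq_zero_of_dehomogenize ?_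
    rw [dehomogenize_map, dehomogenize_homogenize, h0]
  · obtain ⟨f, hf⟩ := R.aug_surjective 1
    refine ⟨dehomogenize (gradedComponent (R.deg 0) 0 f),
      (degreesIn_gradedComponent _ _ _).dehomogenize_mem, ?_⟩
    -- Elements of `I` have no constant term, so `φ f` has constant term `1`, and the component of
    -- `f` in degree `0` is the required lift of `1`.
    have h1 : 1 - φ f () ∈ I := by
      rw [← Ideal.Quotient.eq_zero_iff_mem, map_sub, map_one, ← haug, hf, sub_self]
    have h2 := hI _ h1
    rw [MvPolynomial.coeff_sub, MvPolynomial.coeff_zero_one, sub_eq_zero] at h2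
    have h3 := congrArg (MvPolynomial.coeff 0)
      (hφσ 0 _ (degreesIn_gradedComponent (R.deg 0) 0 f))
    rw [map_gradedComponent hφd, coeff_gradedComponent, if_pos (add_zero _), ← h2,
      MvPolynomial.coeff_monomial, if_pos rfl] at h3
    exact h3.symm
  · intro σ x hx h
    refine lift 0 σ x hx ?_
    rw [R.exact_zero, LinearMap.mem_ker, haug0, hφσ σ _ (degreesIn_homogenize hx),
      dehomogenize_homogenize]
    rcases h with h | h
    · rw [← mul_one (ε x), ← MvPolynomial.C_mul_monomial]
      exact I.mul_mem_left _ h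
    · rw [h, map_zero]
      exact I.zero_mem
  · intro σ hσ x hx
    have h1 : R.d 0 (homogenize (R.deg 1) σ x) ∈ LinearMap.ker R.aug :=
      R.exact_zero ▸ LinearMap.mem_range_self _ _
    rw [LinearMap.mem_ker, haug0, hφσ σ _ ((degreesIn_homogenize hx).map (hd 0)),
      dehomogenize_map, dehomogenize_homogenize] at h1
    by_contra hne
    apply hσ
    have h2 := I.mul_mem_left (MvPolynomial.C (ε (dehomogenizeMap (R.d 0) x))⁻¹) h1
    rwa [MvPolynomial.C_mul_monomial, inv_mul_cancel₀ hne] at h2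
  · intro F u v hu hv hPu hPv
    have hne : u ≠ v := fun e => hPv (e ▸ hPu)
    have hle : Finsupp.single u 1 + Finsupp.single v 1 ≤ zeroOneVector Fᶜ := by
      intro w
      rw [zeroOneVector_apply, Finsupp.add_apply, Finsupp.single_apply, Finsupp.single_apply]
      by_cases h1 : u = w
      · subst h1
        rw [if_pos rfl, if_neg hne.symm, if_pos (Finset.mem_compl.2 hu), add_zero]
      · by_cases h2 : v = w
        · subst h2
          rw [if_neg h1, if_pos rfl, if_pos (Finset.mem_compl.2 hv), zero_add]
        · rw [if_neg h1, if_neg h2]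
          exact Nat.zero_le _
    have h1 := I.mul_mem_left (MvPolynomial.monomial
      (zeroOneVector Fᶜ - (Finsupp.single u 1 + Finsupp.single v 1)) (1 : K)) (hPI u v hPu hPv)
    rwa [MvPolynomial.X, MvPolynomial.X, MvPolynomial.monomial_mul, MvPolynomial.monomial_mul,
      mul_one, mul_one, tsub_add_cancel_of_le hle] at h1
  · intro v h
    apply hX v
    have : zeroOneVector (Finset.univ.erase v)ᶜ = Finsupp.single v 1 := by
      ext w
      rw [zeroOneVector_apply, Finsupp.single_apply]
      simp [eq_comm]
    rwa [this] at h

end Resolution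

/-! ### Existence of minimal graded resolutions -/

section MinimalResolution

variable {V K : Type*} [Field K] {ι : Type*}

/-- A submodule of a graded free module that contains the components of its elements. -/
def IsGradedSubmodule (deg : ι → V →₀ ℕ)
    (N : Submodule (MvPolynomial V K) (ι → MvPolynomial V K)) : Prop :=
  ∀ f ∈ N, ∀ δ, gradedComponent deg δ f ∈ N

theorem mem_variablesIdeal_of_coeff_zero {p : MvPolynomial V K} (hp : MvPolynomial.coeff 0 p = 0) :
    p ∈ variablesIdeal V K := by
  rw [p.as_sum]
  refine Ideal.sum_mem _ fun u hu => monomial_mem_variablesIdeal ?_ _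
  rintro rfl
  exact MvPolynomial.mem_support_iff.1 hu hp

theorem mem_variablesIdeal_smul_top [Fintype ι] {f : ι → MvPolynomial V K}
    (hf : ∀ b, f b ∈ variablesIdeal V K) :
    f ∈ variablesIdeal V K • (⊤ : Submodule (MvPolynomial V K) (ι → MvPolynomial V K)) := by
  classical
  rw [pi_eq_sum_univ f]
  exact Submodule.sum_mem _ fun b _ => Submodule.smul_mem_smul (hf b) trivial

theorem exists_finset_sum_gradedComponent [Fintype ι] (deg : ι → V →₀ ℕ)
    (f : ι → MvPolynomial V K) :
    ∃ s : Finset (V →₀ ℕ), ∑ δ ∈ s, gradedComponent deg δ f = f := by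
  classical
  refine ⟨Finset.univ.biUnion fun b => (f b).support.image fun u => deg b + u, ?_⟩
  funext b
  ext u
  rw [Finset.sum_apply, MvPolynomial.coeff_sum]
  simp only [coeff_gradedComponent, Finset.sum_ite_eq]
  split_ifs with h
  · rfl
  · by_contra hne
    refine h (Finset.mem_biUnion.2 ⟨b, Finset.mem_univ b, Finset.mem_image_of_mem _ ?_⟩)
    exact MvPolynomial.mem_support_iff.2 (Ne.symm hne)

/-- By Noetherianity there is a finite generating set; its finitely many relevant homogeneous
components generate as well. -/
theorem IsGradedSubmodule.exists_homogeneous_generators [Finite V] [Fintype ι]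
    {deg : ι → V →₀ ℕ} {N : Submodule (MvPolynomial V K) (ι → MvPolynomial V K)}
    (hN : IsGradedSubmodule deg N) :
    ∃ (r : ℕ) (deg' : Fin r → V →₀ ℕ) (x : Fin r → ι → MvPolynomial V K),
      (∀ k, DegreesIn deg {deg' k} (x k)) ∧ Submodule.span (MvPolynomial V K) (Set.range x) = N := by
  classical
  obtain ⟨T, hT⟩ := IsNoetherian.noetherian N
  choose s hs using fun f : ι → MvPolynomial V K => exists_finset_sum_gradedComponent deg f
  set J := T.sigma s
  refine ⟨_, fun k => (J.equivFin.symm k).1.2,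
    fun k => gradedComponent deg (J.equivFin.symm k).1.2 (J.equivFin.symm k).1.1,
    fun k => degreesIn_gradedComponent _ _ _, le_antisymm ?_ ?_⟩
  · rw [Submodule.span_le]
    rintro _ ⟨k, rfl⟩
    refine hN _ ?_ _
    rw [← hT]
    exact Submodule.subset_span (Finset.mem_sigma.1 (J.equivFin.symm k).2).1
  · rw [← hT, Submodule.span_le]
    intro f hf
    rw [← hs f]
    refine Submodule.sum_mem _ fun δ hδ => Submodule.subset_span ?_
    refine ⟨J.equivFin ⟨⟨f, δ⟩, Finset.mem_sigma.2 ⟨hf, hδ⟩⟩, ?_⟩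
    simp only [Equiv.symm_apply_apply]

/-- Take the least possible number of homogeneous generators. A relation with a nonzero constant
term in some coordinate would make that generator redundant, so the kernel lies in `𝔪` times the
free module. -/
theorem IsGradedSubmodule.exists_minimal_cover [Finite V] [Fintype ι]
    {deg : ι → V →₀ ℕ} {N : Submodule (MvPolynomial V K) (ι → MvPolynomial V K)}
    (hN : IsGradedSubmodule deg N) :
    ∃ (r : ℕ) (deg' : Fin r → V →₀ ℕ)
      (F : (Fin r → MvPolynomial V K) →ₗ[MvPolynomial V K] (ι → MvPolynomial V K)),
      (∀ b, DegreesIn deg {deg' b} (F (Pi.single b 1))) ∧ LinearMap.range F = N ∧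
      IsGradedSubmodule deg' (LinearMap.ker F) ∧ LinearMap.ker F ≤
        variablesIdeal V K • (⊤ : Submodule (MvPolynomial V K) (Fin r → MvPolynomial V K)) := by
  classical
  have hex := hN.exists_homogeneous_generators
  obtain ⟨deg', x, hx, hspan⟩ := Nat.find_spec hex
  have hmin := fun k hk => Nat.find_min hex (m := k) hk
  revert deg' x
  generalize Nat.find hex = r at hmin
  intro deg' x hx hspan
  have hF : ∀ b, DegreesIn deg {deg' b}
      (Fintype.linearCombination (MvPolynomial V K) x (Pi.single b 1)) := by
    intro b
    rw [Fintype.linearCombination_apply_single, one_smul]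
    exact hx b
  have hker : IsGradedSubmodule deg' (LinearMap.ker (Fintype.linearCombination (MvPolynomial V K) x)) := by
    intro f hf δ
    rw [LinearMap.mem_ker] at hf ⊢
    rw [map_gradedComponent hF, hf]
    exact ((DegreesIn.zero deg _).gradedComponent_eq_zero)
  refine ⟨r, deg', Fintype.linearCombination (MvPolynomial V K) x, hF, ?_, hker, ?_⟩
  · rw [Fintype.range_linearCombination, hspan]
  · intro f hf
    refine mem_variablesIdeal_smul_top fun b => mem_variablesIdeal_of_coeff_zero ?_
    by_contra hne
    obtain ⟨r, rfl⟩ : ∃ k, r = k + 1 := ⟨r - 1, by have := b.2; omega⟩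
    refine hmin r (Nat.lt_succ_self r) ⟨fun k => deg' (b.succAbove k), fun k => x (b.succAbove k),
      fun k => hx _, ?_⟩
    -- In degree `deg' b` the coordinate at `b` is exactly the constant term of `f b`, a unit; the
    -- component is still a relation because the kernel is graded.
    set h := gradedComponent deg' (deg' b) f with hh
    have hb : h b = MvPolynomial.C (MvPolynomial.coeff 0 (f b)) := by
      ext u
      rw [hh, coeff_gradedComponent, MvPolynomial.coeff_C]
      by_cases hu : u = 0
      · rw [hu, add_zero, if_pos rfl, if_pos rfl]
      · rw [if_neg fun e => hu (by simpa using e), if_neg fun e => hu e.symm]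
    have h0 := hker f hf (deg' b)
    rw [LinearMap.mem_ker, Fintype.linearCombination_apply, Fin.sum_univ_succAbove _ b, ← hh, hb]
      at h0
    have hxb : x b ∈ Submodule.span (MvPolynomial V K) (Set.range fun k => x (b.succAbove k)) := by
      have h1 : x b = MvPolynomial.C (σ := V) (MvPolynomial.coeff 0 (f b))⁻¹ •
          (- ∑ k, h (b.succAbove k) • x (b.succAbove k)) := by
        rw [← eq_neg_of_add_eq_zero_left h0, smul_smul, ← map_mul, inv_mul_cancel₀ hne, map_one,
          one_smul]
      rw [h1]
      exact Submodule.smul_mem _ _ (Submodule.neg_mem _ (Submodule.sum_mem _ fun k _ =>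
        Submodule.smul_mem _ _ (Submodule.subset_span ⟨k, rfl⟩)))
    rw [← hspan]
    refine le_antisymm (Submodule.span_mono ?_) (Submodule.span_le.2 ?_)
    · rintro _ ⟨k, rfl⟩
      exact ⟨_, rfl⟩
    · rintro _ ⟨k, rfl⟩
      rcases Fin.eq_self_or_eq_succAbove b k with rfl | ⟨k, rfl⟩
      · exact hxb
      · exact Submodule.subset_span ⟨k, rfl⟩

/-- A graded free module of finite rank with a graded submodule of `𝔪` times it: the last stage of
a minimal resolution that is being built. -/
structure ResolutionStage (V K : Type*) [Field K] where
  /-- the rank of the free module -/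
  rank : ℕ
  /-- the degrees of its generators -/
  deg : Fin rank → V →₀ ℕ
  /-- the submodule that remains to be resolved -/
  syzygies : Submodule (MvPolynomial V K) (Fin rank → MvPolynomial V K)
  isGraded : IsGradedSubmodule deg syzygies
  le_smul_top : syzygies ≤
    variablesIdeal V K • (⊤ : Submodule (MvPolynomial V K) (Fin rank → MvPolynomial V K))

theorem ResolutionStage.exists_next [Finite V] (A : ResolutionStage V K) :
    ∃ (B : ResolutionStage V K)
      (F : (Fin B.rank → MvPolynomial V K) →ₗ[MvPolynomial V K] (Fin A.rank → MvPolynomial V K)),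
      (∀ b, DegreesIn A.deg {B.deg b} (F (Pi.single b 1))) ∧ LinearMap.range F = A.syzygies ∧
        LinearMap.ker F = B.syzygies := by
  obtain ⟨r, deg', F, hF, hrange, hker, hle⟩ := A.isGraded.exists_minimal_cover
  exact ⟨⟨r, deg', LinearMap.ker F, hker, hle⟩, F, hF, hrange, rfl⟩

/-- Start with `I` as a submodule of the free module of rank one and iterate minimal covers. `hI`
makes `I` graded, and `hI0` places it inside `𝔪`. -/
theorem nonempty_minimal_multigradedFreeResolution [Finite V] {I : Ideal (MvPolynomial V K)}
    (hI : ∀ p ∈ I, ∀ u ∈ p.support, MvPolynomial.monomial u (1 : K) ∈ I)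
    (hI0 : ∀ p ∈ I, MvPolynomial.coeff 0 p = 0) :
    Nonempty {F : MultigradedFreeResolution I // F.IsMinimal} := by
  classical
  let A₀ : ResolutionStage V K :=
    { rank := 1
      deg := fun _ => 0
      syzygies := LinearMap.ker ((Submodule.mkQ I).comp (LinearMap.proj (0 : Fin 1) :
        (Fin 1 → MvPolynomial V K) →ₗ[MvPolynomial V K] MvPolynomial V K))
      isGraded := by
        intro f hf δ
        replace hf : f 0 ∈ I := (Submodule.Quotient.mk_eq_zero I).1 hf
        refine (Submodule.Quotient.mk_eq_zero I).2 ?_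
        change gradedComponent (fun _ : Fin 1 => (0 : V →₀ ℕ)) δ f 0 ∈ I
        rw [gradedComponent]
        split_ifs
        · by_cases h : MvPolynomial.coeff (δ - 0) (f 0) = 0
          · rw [h, map_zero]
            exact I.zero_mem
          · have h1 := I.mul_mem_left (MvPolynomial.C (MvPolynomial.coeff (δ - 0) (f 0)))
              (hI _ hf _ (MvPolynomial.mem_support_iff.2 h))
            rwa [MvPolynomial.C_mul_monomial, mul_one] at h1
        · exact I.zero_mem
      le_smul_top := by
        intro f hf
        replace hf : f 0 ∈ I := (Submodule.Quotient.mk_eq_zero I).1 hf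
        refine mem_variablesIdeal_smul_top fun b => mem_variablesIdeal_of_coeff_zero ?_
        rw [Subsingleton.elim b 0]
        exact hI0 _ hf }
  choose next F hF hrange hker using fun A : ResolutionStage V K => A.exists_next
  let A : ℕ → ResolutionStage V K := fun i => Nat.rec A₀ (fun _ B => next B) i
  let R : MultigradedFreeResolution I :=
    { rank := fun i => (A i).rank
      deg := fun i => (A i).deg
      d := fun i => F (A i)
      aug := I.mkQ.comp (LinearMap.proj (0 : Fin 1))
      d_homogeneous := fun i b b' u hu => hF (A i) b b' u hu
      aug_homogeneous := by
        intro b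
        refine ⟨1, ?_⟩
        have hb : b = (0 : Fin 1) := Subsingleton.elim (α := Fin 1) _ _
        subst hb
        rfl
      aug_surjective := by
        intro q
        obtain ⟨p, rfl⟩ := Ideal.Quotient.mk_surjective q
        exact ⟨fun _ => p, rfl⟩
      exact_zero := hrange A₀
      exact_succ := fun i => (hrange (A (i + 1))).trans (hker (A i)).symm }
  refine ⟨R, fun i => ?_⟩
  change LinearMap.range (F (A i)) ≤ _
  rw [hrange]
  exact (A i).le_smul_top

end MinimalResolution

/-! ### Conclusion for the edge ideal -/

theorem lemma4p1 {V : Type*} [Fintype V] (K : Type*) [Field K] (G : SimpleGraph V) (m n : ℕ)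
    (hm : 1 ≤ m) (hn : 1 ≤ n) (hG : HasSpanningCompleteBipartite G m n) :
    (∃ (μ : ℕ) (g : Fin μ ≃ minimalMonomialGenerators (edgeIdeal K G)),
      HasMaximalCycle K (fun l => (g l : V →₀ ℕ)) (m + n - 1) (zeroOneVector Finset.univ)) ∧
    multigradedBetti (edgeIdeal K G) (m + n - 1) (zeroOneVector Finset.univ) ≠ 0 := by
  obtain ⟨M, rfl⟩ : ∃ M, m = M + 1 := ⟨m - 1, by omega⟩
  obtain ⟨N, rfl⟩ : ∃ N, n = N + 1 := ⟨n - 1, by omega⟩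
  obtain ⟨α, β, hα, hβ, hαβ, hcover, hadj⟩ := hG.exists_parts
  have hMN : M + 1 + (N + 1) - 1 = M + N + 1 := by omega
  rw [hMN]
  constructor
  · obtain ⟨μ, g, c, hg⟩ := exists_isStaircaseOrder K G hα hβ hαβ hcover hadj
    exact ⟨μ, g, hg.hasMaximalCycle K⟩
  -- The homological degree `m + n - 1` is `|V| - 1`, as the zigzag requires.
  · have hcard : M + N + 1 + 1 = Fintype.card V := by
      have hbij : Function.Bijective (Sum.elim α β) :=
        ⟨hα.sumElim hβ hαβ, fun v => (hcover v).elim (fun ⟨i, hi⟩ => ⟨Sum.inl i, hi⟩)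
          fun ⟨j, hj⟩ => ⟨Sum.inr j, hj⟩⟩
      have h := Fintype.card_of_bijective hbij
      rw [Fintype.card_sum, Fintype.card_fin, Fintype.card_fin] at h
      omega
    have hdeg : ∀ w : V →₀ ℕ, MvPolynomial.monomial w (1 : K) ∈ edgeIdeal K G → 2 ≤ w.degree := by
      intro w hw
      obtain ⟨u, v, -, hle⟩ := (monomial_mem_edgeIdeal_iff K G w).1 hw
      have h := Finsupp.degree_mono hle
      rwa [map_add, Finsupp.degree_single, Finsupp.degree_single] at h
    have hI0 : ∀ p ∈ edgeIdeal K G, MvPolynomial.coeff 0 p = 0 := by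
      intro p hp
      by_contra h
      have h1 := hdeg 0 (monomial_mem_edgeIdeal_of_mem_support K G hp
        (MvPolynomial.mem_support_iff.2 h))
      rw [map_zero] at h1
      omega
    have hne := nonempty_minimal_multigradedFreeResolution
      (fun p hp u hu => monomial_mem_edgeIdeal_of_mem_support K G hp hu) hI0
    rw [multigradedBetti, dif_pos hne, MultigradedFreeResolution.multiplicity]
    -- The separating predicate `P` is membership in the side `α`; all variables lie outside the
    -- ideal, whose monomials have degree at least two.
    obtain ⟨b, hb⟩ := (Classical.choice hne).1.exists_deg_eq_univ hI0 (fun v => ∃ i, α i = v)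
      ⟨α 0, 0, rfl⟩ ⟨β 0, fun ⟨i, hi⟩ => hαβ i 0 hi⟩
      (by
        rintro _ v ⟨i, rfl⟩ hv
        obtain ⟨j, rfl⟩ := (hcover v).resolve_left hv
        exact Ideal.subset_span ⟨_, _, hadj i j, rfl⟩)
      (fun v hv => by
        have h := hdeg (Finsupp.single v 1) hv
        rw [Finsupp.degree_single] at h
        omega) hcard
    have : Nonempty {b // (Classical.choice hne).1.deg (M + N + 1) b =
        zeroOneVector Finset.univ} := ⟨⟨b, hb⟩⟩
    exact Nat.card_pos.ne'
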